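/- Let $\{X(p)\}_{p\ \mathrm{prime}}$ be independent random variables, each uniformly distributed on the unit circle, and let $$L(1,X)=\lim_{y\to\infty}\prod_{p\le y}\Bigl(1-\frac{X(p)}{p}\Bigr)^{-1},\qquad \arg L(1,X)=\lim_{y\to\infty}\sum_{p\le y}\arg\Bigl(1-\frac{X(p)}{p}\Bigr)^{-1},$$ where the argument of each factor is taken in $(-\pi/2,\pi/2)$; both limits exist with probability $1$. For $\tau,\theta>0$ put $$\Phi(\tau,\theta)=\mathrm{Prob}\bigl(|L(1,X)|>e^{\gamma}\tau,\ |\arg L(1,X)|>\theta\bigr),$$ where $\gamma$ is Euler's constant. Then for every real $A$ there are constants $C>0$ and $\tau_0>1$, depending only on $A$, such that for all $\tau\ge\tau_0$ and all $\theta$ with $$(\log\tau)\sqrt{\frac{\log\log\tau}{\tau}}<\theta\le A$$ one has $$\Phi(\tau,\theta)=\exp\left(-\frac{1}{\tau}\exp\left(\tau+\frac{\theta^2\tau}{2\log\tau}+E\right)\right)\quad\text{for some real } E=E(\tau,\theta) \text{ with } |E|\le C\,\frac{\theta^2\tau}{\log^2\tau}.$$ -/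

import Mathlib

open Filter Topology MeasureTheory ProbabilityTheory

noncomputable section

/-- The uniform probability measure on the unit circle of `ℂ`: the law of `exp (i t)` for `t`
uniformly distributed on `(-π, π]`. -/
def circleUniform : Measure ℂ :=
  (volume[|Set.Ioc (-Real.pi) Real.pi]).map (fun t : ℝ => Complex.exp (t * Complex.I))

/-- The finite set of the primes `p ≤ y`, as a set of elements of `Nat.Primes`. -/
def primesUpTo (y : ℕ) : Finset Nat.Primes :=
  (Finset.range (y + 1)).subtype Nat.Prime

theorem mem_primesUpTo {y : ℕ} {p : Nat.Primes} : p ∈ primesUpTo y ↔ (p : ℕ) ≤ y :=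
  Finset.mem_subtype.trans (Finset.mem_range.trans Nat.lt_succ_iff)

/-- `IsSteinhaus P X`: the random variables `X p`, one for each prime `p`, are independent and
each is uniformly distributed on the unit circle. -/
structure IsSteinhaus {Ω : Type*} [MeasurableSpace Ω] (P : Measure Ω)
    (X : Nat.Primes → Ω → ℂ) : Prop where
  law : ∀ p, HasLaw (X p) circleUniform P
  indep : iIndepFun X P

/-- The Euler factor `(1 - x p / p)⁻¹` of a family `x` of complex numbers indexed by primes. -/
def eulerFactor (x : Nat.Primes → ℂ) (p : Nat.Primes) : ℂ :=
  (1 - x p / ((p : ℕ) : ℂ))⁻¹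

/-- The truncated Euler product over the primes `p ≤ y`. -/
def eulerPartial (x : Nat.Primes → ℂ) (y : ℕ) : ℂ :=
  ∏ p ∈ primesUpTo y, eulerFactor x p

/-- The argument of the truncated Euler product: the sum of the arguments of its factors. For
`|x p| ≤ 1` each factor has positive real part, so that its principal argument lies in
`(-π/2, π/2)` and the sum is the value at `σ = 1` of the argument of
`∏_{p ≤ y} (1 - x p / p ^ σ)⁻¹` continued along the real line from `σ = ∞`, where it is `0`. -/
def argPartial (x : Nat.Primes → ℂ) (y : ℕ) : ℝ :=
  ∑ p ∈ primesUpTo y, (eulerFactor x p).arg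

/-- `L(1, x)`, the limit of the truncated Euler products. -/
def eulerL (x : Nat.Primes → ℂ) : ℂ :=
  limUnder atTop (eulerPartial x)

/-- `arg L(1, x)`, the limit of the arguments of the truncated Euler products. -/
def argL (x : Nat.Primes → ℂ) : ℝ :=
  limUnder atTop (argPartial x)

/-- `Φ(τ, θ)`, the probability that `|L(1, X)| > e ^ γ τ` and `|arg L(1, X)| > θ`. -/
def jointTail {Ω : Type*} [MeasurableSpace Ω] (P : Measure Ω) (X : Nat.Primes → Ω → ℂ)
    (τ θ : ℝ) : ℝ :=
  P.real {ω | Real.exp Real.eulerMascheroniConstant * τ < ‖eulerL (fun p => X p ω)‖ ∧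
    θ < |argL (fun p => X p ω)|}

end

/-! Write `θ = β log τ`. The claim then says that `-log Φ` is `exp(τ + β² τ log τ / 2 + O(β² τ)) /
τ`. The limit `log L(1, X)` exists almost surely because `∑ X(p)/p` is an L¹-bounded martingale and
the rest of the logarithm converges absolutely.

Upper bound: on the event, the projection of `log L` on one of the directions `exp(± iβ)` exceeds
`cos β (γ + log τ) + θ sin β = γ + log τ + β² log τ / 2 + O(β²)`. The primes up to `y` contribute at
most `∑ -log(1 - 1/p)`, which by Mertens' third theorem is `log log y + γ + O(1 / log y)`. Take `log
y` close to `τ exp(β² log τ / 2 - K β²)`; then these primes fall short of the threshold, and the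
primes above `y` must supply the difference. A Chernoff bound with parameter of modulus `y` makes
this as unlikely as `exp(-c y / τ)` (`IsSteinhaus.jointTail_le_two_mul_exp`, `exists_jointTail_le`).

Lower bound: take `log y` slightly larger, with `+K β²` in place of `-K β²`, and force all `X(p)`
with `p ≤ y` onto an arc of half-width `1/τ` about `exp(iα)`, where `α = β + O(β / log τ)`. The real
part loses about `α² log log y / 2` and the imaginary part is about `α log log y`, so both
thresholds are passed; independently, the tail does no harm with conditional probability at least
`1/2`. The cost is `(1/(πτ))` to the power `π(y) = O(y / τ)`. The surplus factor `log τ` in the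
exponent is absorbed by `exp(O(β² τ))`, since the lower bound on `θ` means `log log τ < β² τ`
(`IsSteinhaus.le_jointTail`, `exists_le_jointTail`).

Both halves need the exact constant `γ` in Mertens' theorem with error `O(1 / log y)`; this is
`exists_mertens`. -/

/-! ### Mertens' theorems -/

section Mertens

open Nat (primesLE)

theorem sum_primesLE_succ {M : Type*} [AddCommMonoid M] (f : ℕ → M) (n : ℕ) :
    ∑ p ∈ primesLE (n + 1), f p =
      (∑ p ∈ primesLE n, f p) + if (n + 1).Prime then f (n + 1) else 0 := by
  simp only [Nat.primesLE_eq_filter_range, Finset.sum_filter]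
  rw [Finset.sum_range_succ]

theorem sum_primesUpTo {M : Type*} [AddCommMonoid M] (f : ℕ → M) (n : ℕ) :
    ∑ p ∈ primesUpTo n, f p = ∑ p ∈ primesLE n, f p := by
  rw [Nat.primesLE_eq_filter_range, primesUpTo, ← Finset.subtype_map, Finset.sum_map]
  rfl

theorem summable_log_div_mul_sub_one :
    Summable fun n : ℕ => Real.log n / ((n : ℝ) * (n - 1)) := by
  have h : Summable fun n : ℕ => (4 : ℝ) * (n : ℝ) ^ (-(3 / 2) : ℝ) :=
    (Real.summable_nat_rpow.2 (by norm_num)).mul_left _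
  refine Summable.of_norm_bounded h fun n => ?_
  rcases Nat.lt_or_ge n 2 with hn | hn
  · interval_cases n <;> simp
  have hn' : (2 : ℝ) ≤ n := by exact_mod_cast hn
  rw [Real.norm_of_nonneg (div_nonneg (Real.log_nonneg (by linarith)) (by nlinarith)),
    div_le_iff₀ (by nlinarith)]
  have h1 : Real.log n ≤ (n : ℝ) ^ (1 / 2 : ℝ) / (1 / 2) :=
    Real.log_le_rpow_div (by positivity) (by norm_num)
  have h2 : (n : ℝ) ^ (-(3 / 2) : ℝ) * (n : ℝ) ^ 2 = (n : ℝ) ^ (1 / 2 : ℝ) := by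
    rw [← Real.rpow_natCast, ← Real.rpow_add (by linarith)]
    norm_num
  have h3 : 0 ≤ (n : ℝ) ^ (-(3 / 2) : ℝ) := by positivity
  calc Real.log n ≤ 2 * (n : ℝ) ^ (1 / 2 : ℝ) := by linarith
    _ = 4 * (n : ℝ) ^ (-(3 / 2) : ℝ) * ((n : ℝ) ^ 2 / 2) := by rw [← h2]; ring
    _ ≤ 4 * (n : ℝ) ^ (-(3 / 2) : ℝ) * ((n : ℝ) * (n - 1)) := by
      gcongr
      nlinarith

theorem log_factorial_eq_sum_primesLE (n : ℕ) :
    Real.log (n.factorial) =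
      ∑ p ∈ primesLE n, (n.factorial.factorization p : ℝ) * Real.log p := by
  rw [Real.log_nat_eq_sum_factorization, Finsupp.sum]
  refine Finset.sum_subset (fun p hp => ?_) fun p _ hp => ?_
  · rw [Nat.support_factorization] at hp
    have h := Nat.prime_of_mem_primeFactors hp
    exact Nat.mem_primesLE.2 ⟨h.dvd_factorial.1 (Nat.dvd_of_mem_primeFactors hp), h⟩
  · rw [Finsupp.notMem_support_iff.1 hp]
    simp

theorem factorization_factorial_ge {n p : ℕ} (hp : p.Prime) :
    (n : ℝ) / p - 1 ≤ n.factorial.factorization p := by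
  have h : n / p ≤ n.factorial.factorization p := by
    rw [Nat.factorization_factorial hp (b := Nat.log p n + 2) (by omega)]
    have : (1 : ℕ) ∈ Finset.Ico 1 (Nat.log p n + 2) := by simp
    simpa using Finset.single_le_sum (f := fun i => n / p ^ i) (fun i _ => Nat.zero_le _) this
  have h1 : (n : ℝ) / p < (n / p : ℕ) + 1 := by
    rw [div_lt_iff₀ (by exact_mod_cast hp.pos)]
    exact_mod_cast Nat.lt_mul_of_div_lt (Nat.lt_succ_self _) hp.pos
  have h2 : ((n / p : ℕ) : ℝ) ≤ n.factorial.factorization p := by exact_mod_cast h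
  linarith

theorem factorization_factorial_le {n p : ℕ} (hp : p.Prime) :
    (n.factorial.factorization p : ℝ) ≤ (n : ℝ) / (p - 1) := by
  have h := Nat.factorization_factorial_le_div_pred hp n
  have h1 : ((n / (p - 1) : ℕ) : ℝ) ≤ n / ((p - 1 : ℕ) : ℝ) := Nat.cast_div_le
  rw [Nat.cast_sub hp.one_le, Nat.cast_one] at h1
  exact (Nat.cast_le.2 h).trans h1

/-- **Mertens' first theorem**. -/
theorem exists_abs_sum_log_div_sub_log_le :
    ∃ B : ℝ, 0 ≤ B ∧ ∀ n : ℕ, 1 ≤ n →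
      |(∑ p ∈ primesLE n, Real.log p / p) - Real.log n| ≤ B := by
  set c := ∑' n : ℕ, Real.log n / ((n : ℝ) * (n - 1)) with hc
  have hnn : ∀ n : ℕ, 0 ≤ Real.log n / ((n : ℝ) * (n - 1)) := fun n => by
    rcases Nat.eq_zero_or_pos n with rfl | hn
    · simp
    · have : (1 : ℝ) ≤ n := by exact_mod_cast hn
      exact div_nonneg (Real.log_nonneg this) (by nlinarith)
  have hc0 : 0 ≤ c := tsum_nonneg hnn
  refine ⟨Real.log 4 + 1 + c, by have := Real.log_nonneg (show (1 : ℝ) ≤ 4 by norm_num); linarith,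
    fun n hn => ?_⟩
  have hn0 : (0 : ℝ) < n := by exact_mod_cast hn
  have hn1 : (1 : ℝ) ≤ n := by exact_mod_cast hn
  have hfac : (0 : ℝ) < n.factorial := by exact_mod_cast n.factorial_pos
  have hup : Real.log n.factorial ≤ n * Real.log n := by
    rw [← Real.log_pow]
    exact Real.log_le_log hfac (by exact_mod_cast Nat.factorial_le_pow n)
  -- The elementary half of Stirling's formula: `n ^ n / n!` is a single term of the series of `exp
  -- n`.
  have hlo : n * Real.log n - n ≤ Real.log n.factorial := by
    have h := Real.pow_div_factorial_le_exp (x := n) hn0.le n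
    have h2 := Real.log_le_log (by positivity) h
    rw [Real.log_exp, Real.log_div (by positivity) hfac.ne', Real.log_pow] at h2
    linarith
  -- Legendre's exponent of `p` in `n!` lies between `n/p - 1` and `n/(p-1)`. The loss of `1` here
  -- sums to Chebyshev's `θ(n) ≤ n log 4`; the excess of `1/(p-1)` over `1/p` in the next bound sums
  -- to the convergent series `c`.
  have h1 : n * (∑ p ∈ primesLE n, Real.log p / p) - Real.log 4 * n ≤ Real.log n.factorial := by
    have ht := Chebyshev.theta_le_log4_mul_x hn0.le
    rw [Chebyshev.theta_eq_sum_primesLE_log] at ht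
    rw [log_factorial_eq_sum_primesLE]
    calc _ ≤ n * (∑ p ∈ primesLE n, Real.log p / p) - ∑ p ∈ primesLE n, Real.log p := by linarith
      _ = ∑ p ∈ primesLE n, ((n : ℝ) / p - 1) * Real.log p := by
        rw [Finset.mul_sum, ← Finset.sum_sub_distrib]
        exact Finset.sum_congr rfl fun p _ => by ring
      _ ≤ _ := Finset.sum_le_sum fun p hp =>
        mul_le_mul_of_nonneg_right (factorization_factorial_ge (Nat.prime_of_mem_primesLE hp))
          (Real.log_natCast_nonneg p)
  have h2 : Real.log n.factorial ≤ n * ((∑ p ∈ primesLE n, Real.log p / p) + c) := by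
    rw [log_factorial_eq_sum_primesLE]
    calc _ ≤ ∑ p ∈ primesLE n, (n : ℝ) / (p - 1) * Real.log p := Finset.sum_le_sum fun p hp =>
          mul_le_mul_of_nonneg_right (factorization_factorial_le (Nat.prime_of_mem_primesLE hp))
            (Real.log_natCast_nonneg p)
      _ = n * ((∑ p ∈ primesLE n, Real.log p / p) +
            ∑ p ∈ primesLE n, Real.log p / ((p : ℝ) * (p - 1))) := by
        rw [← Finset.sum_add_distrib, Finset.mul_sum]
        refine Finset.sum_congr rfl fun p hp => ?_
        have : (1 : ℝ) < p := by exact_mod_cast Nat.one_lt_of_mem_primesLE hp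
        have h3 : (p : ℝ) - 1 ≠ 0 := by linarith
        field_simp
        ring
      _ ≤ _ := by
        gcongr
        exact summable_log_div_mul_sub_one.sum_le_tsum _ fun i _ => hnn i
  rw [abs_le]
  constructor
  · have : n * (Real.log n - 1) ≤ n * ((∑ p ∈ primesLE n, Real.log p / p) + c) := by linarith
    have := le_of_mul_le_mul_left this hn0
    have := Real.log_nonneg (show (1 : ℝ) ≤ 4 by norm_num)
    linarith
  · have : n * (∑ p ∈ primesLE n, Real.log p / p) ≤ n * (Real.log n + Real.log 4) := by linarith
    have := le_of_mul_le_mul_left this hn0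
    linarith

/-- **Mertens' second theorem**, with an unspecified constant. -/
theorem exists_abs_sum_one_div_sub_log_log_le :
    ∃ c B : ℝ, 0 ≤ B ∧ ∀ n : ℕ, 2 ≤ n →
      |(∑ p ∈ primesLE n, 1 / (p : ℝ)) - Real.log (Real.log n) - c| ≤ B / Real.log n := by
  obtain ⟨B, hB0, hB⟩ := exists_abs_sum_log_div_sub_log_le
  set R : ℕ → ℝ := fun n => (∑ p ∈ primesLE n, Real.log p / p) - Real.log n with hR
  -- Discrete partial summation. Subtracting `R n / log n` cancels the jump of `∑ 1/p` at each
  -- prime, so the increments of `D` are dominated by those of the telescoping sequence `-1 / log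
  -- n`. Hence `D` is Cauchy with rate `O(1 / log n)`.
  set D : ℕ → ℝ := fun n =>
    (∑ p ∈ primesLE n, 1 / (p : ℝ)) - Real.log (Real.log n) - R n / Real.log n with hD
  have step : ∀ n : ℕ, 2 ≤ n →
      |D (n + 1) - D n| ≤ (B + 1) * (1 / Real.log n - 1 / Real.log (n + 1 : ℕ)) := by
    intro n hn
    have hn' : (2 : ℝ) ≤ n := by exact_mod_cast hn
    set L' := Real.log n with hLd
    set L := Real.log (n + 1 : ℕ) with hL
    have hL' : 0 < L' := Real.log_pos (by linarith)
    have hLL : L' ≤ L := Real.log_le_log (by linarith) (by push_cast; linarith)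
    have hL0 : 0 < L := hL'.trans_le hLL
    have hL1 : L - L' ≤ 1 := by
      rw [hL, ← Real.log_div (by positivity) (by positivity)]
      refine (Real.log_le_sub_one_of_pos (by positivity)).trans ?_
      rw [sub_le_iff_le_add, div_le_iff₀ (by positivity)]
      push_cast; linarith
    have key : D (n + 1) - D n =
        R n * (1 / L' - 1 / L) + ((L - L') / L - (Real.log L - Real.log L')) := by
      simp only [hD, hR, sum_primesLE_succ]
      split_ifs
      · have : ((n + 1 : ℕ) : ℝ) ≠ 0 := by positivity
        simp only [← hL, ← hLd]
        field_simp
        ring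
      · simp only [← hL, ← hLd]
        field_simp
        ring
    have h1 : (L - L') / L ≤ Real.log L - Real.log L' := by
      have := Real.one_sub_inv_le_log_of_pos (div_pos hL0 hL')
      rw [Real.log_div hL0.ne' hL'.ne', inv_div] at this
      rwa [sub_div, div_self hL0.ne']
    have h2 : Real.log L - Real.log L' ≤ (L - L') / L' := by
      have := Real.log_le_sub_one_of_pos (div_pos hL0 hL')
      rw [Real.log_div hL0.ne' hL'.ne'] at this
      rwa [sub_div, div_self hL'.ne']
    have h3 : (L - L') / L' - (L - L') / L ≤ 1 / L' - 1 / L := by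
      have : (L - L') / L' - (L - L') / L = (L - L') * (1 / L' - 1 / L) := by ring
      rw [this]
      refine mul_le_of_le_one_left ?_ hL1
      exact sub_nonneg.2 (one_div_le_one_div_of_le hL' hLL)
    have h0 : 0 ≤ 1 / L' - 1 / L := sub_nonneg.2 (one_div_le_one_div_of_le hL' hLL)
    rw [key]
    calc _ ≤ |R n * (1 / L' - 1 / L)| + |(L - L') / L - (Real.log L - Real.log L')| :=
          abs_add_le _ _
      _ ≤ B * (1 / L' - 1 / L) + (1 / L' - 1 / L) := by
        rw [abs_mul, abs_of_nonneg h0]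
        gcongr
        · exact hB n (by omega)
        · rw [abs_le]; constructor <;> linarith
      _ = _ := by ring
  have diff : ∀ N : ℕ, 2 ≤ N → ∀ M, N ≤ M →
      |D M - D N| ≤ (B + 1) * (1 / Real.log N - 1 / Real.log M) := by
    intro N hN M hM
    induction M, hM using Nat.le_induction with
    | base => simp
    | succ M hM ih =>
      have := step M (by omega)
      calc |D (M + 1) - D N| ≤ |D (M + 1) - D M| + |D M - D N| := by
            simpa using abs_sub_le (D (M + 1)) (D M) (D N)
        _ ≤ _ := by linarith
  have diff' : ∀ N : ℕ, 2 ≤ N → ∀ M, N ≤ M → |D M - D N| ≤ (B + 1) / Real.log N := by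
    intro N hN M hM
    refine (diff N hN M hM).trans ?_
    have : 0 ≤ 1 / Real.log M := one_div_nonneg.2 (Real.log_natCast_nonneg M)
    rw [div_eq_mul_one_div (B + 1)]
    exact mul_le_mul_of_nonneg_left (by linarith) (by linarith)
  have hlim0 : Tendsto (fun N : ℕ => (B + 1) / Real.log N) atTop (𝓝 0) :=
    (Real.tendsto_log_atTop.comp tendsto_natCast_atTop_atTop).const_div_atTop (B + 1)
  have hcau : CauchySeq D := by
    rw [Metric.cauchySeq_iff']
    intro ε hε
    obtain ⟨N, hN2, hN⟩ :=
      ((eventually_ge_atTop 2).and (hlim0.eventually (gt_mem_nhds hε))).exists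
    exact ⟨N, fun n hn => (Real.dist_eq _ _).trans_lt ((diff' N hN2 n hn).trans_lt hN)⟩
  obtain ⟨c, hc⟩ := cauchySeq_tendsto_of_complete hcau
  refine ⟨c, 2 * B + 1, by linarith, fun n hn => ?_⟩
  have h1 : |c - D n| ≤ (B + 1) / Real.log n :=
    le_of_tendsto ((hc.sub_const (D n)).abs)
      ((eventually_ge_atTop n).mono fun M hM => diff' n hn M hM)
  have hlog : 0 < Real.log n := Real.log_pos (by exact_mod_cast hn)
  have h2 : |R n / Real.log n| ≤ B / Real.log n := by
    rw [abs_div, abs_of_pos hlog]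
    gcongr
    exact hB n (by omega)
  have : (∑ p ∈ primesLE n, 1 / (p : ℝ)) - Real.log (Real.log n) - c =
      R n / Real.log n - (c - D n) := by simp only [hD]; ring
  rw [this]
  calc _ ≤ |R n / Real.log n| + |c - D n| := abs_sub _ _
    _ ≤ B / Real.log n + (B + 1) / Real.log n := add_le_add h2 h1
    _ = _ := by ring

theorem sum_log_div_sq_le {N M : ℕ} (hN : 1 ≤ N) (hM : N ≤ M) :
    (∑ p ∈ primesLE M, Real.log p / (p : ℝ) ^ 2) - ∑ p ∈ primesLE N, Real.log p / (p : ℝ) ^ 2 ≤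
      2 * Real.log 4 / N := by
  have hl4 : 0 ≤ Real.log 4 := Real.log_nonneg (by norm_num)
  -- The boundary term `θ(M) / M²` of partial summation is kept, so that each step only needs
  -- Chebyshev's bound for `θ(M)`.
  have key : (∑ p ∈ primesLE M, Real.log p / (p : ℝ) ^ 2) -
      ∑ p ∈ primesLE N, Real.log p / (p : ℝ) ^ 2 ≤
      (∑ p ∈ primesLE M, Real.log p) / (M : ℝ) ^ 2 + 2 * Real.log 4 * (1 / N - 1 / M) := by
    induction M, hM using Nat.le_induction with
    | base =>
      simp only [sub_self, mul_zero, add_zero]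
      exact div_nonneg (Finset.sum_nonneg fun p _ => Real.log_natCast_nonneg p) (sq_nonneg _)
    | succ M hM ih =>
      have hM0 : (0 : ℝ) < M := by exact_mod_cast (by omega : 0 < M)
      have hM1 : ((M + 1 : ℕ) : ℝ) = M + 1 := by push_cast; ring
      set T := ∑ p ∈ primesLE M, Real.log p with hT
      have hT1 : T ≤ Real.log 4 * M := by
        have ht := Chebyshev.theta_le_log4_mul_x hM0.le
        rwa [Chebyshev.theta_eq_sum_primesLE_log] at ht
      have h1 : T / (M : ℝ) ^ 2 - T / ((M : ℝ) + 1) ^ 2 ≤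
          2 * Real.log 4 * (1 / M - 1 / (M + 1)) := by
        have e1 : T / (M : ℝ) ^ 2 - T / ((M : ℝ) + 1) ^ 2 =
            T * ((2 * M + 1) / ((M : ℝ) ^ 2 * (M + 1) ^ 2)) := by
          field_simp; ring
        have e2 : 2 * Real.log 4 * (1 / (M : ℝ) - 1 / (M + 1)) =
            Real.log 4 * M * (2 * (M + 1) / ((M : ℝ) ^ 2 * (M + 1) ^ 2)) := by
          field_simp; ring
        rw [e1, e2]
        gcongr
        linarith
      rw [sum_primesLE_succ, sum_primesLE_succ, ← hT, hM1, add_div]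
      have h2 : (if (M + 1).Prime then Real.log ((M + 1 : ℕ) : ℝ) / ((M + 1 : ℕ) : ℝ) ^ 2 else 0) =
          (if (M + 1).Prime then Real.log ((M + 1 : ℕ) : ℝ) else 0) / ((M : ℝ) + 1) ^ 2 := by
        rw [hM1]; split_ifs <;> simp
      rw [hM1] at h2
      rw [h2]
      linarith
  have hM0 : (0 : ℝ) < M := by exact_mod_cast (by omega : 0 < M)
  have hT1 : (∑ p ∈ primesLE M, Real.log p) / (M : ℝ) ^ 2 ≤ Real.log 4 * (1 / M) := by
    have ht := Chebyshev.theta_le_log4_mul_x hM0.le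
    rw [Chebyshev.theta_eq_sum_primesLE_log] at ht
    rw [div_le_iff₀ (by positivity)]
    refine ht.trans_eq ?_
    field_simp
  have : 0 ≤ Real.log 4 * (1 / (M : ℝ)) := by positivity
  have e : 2 * Real.log 4 / (N : ℝ) = 2 * Real.log 4 * (1 / N) := by ring
  rw [e]
  linarith

theorem sum_primesUpTo_sdiff {y z : ℕ} (h : y ≤ z) (f : Nat.Primes → ℝ) :
    ∑ p ∈ primesUpTo z \ primesUpTo y, f p =
      ∑ p ∈ primesUpTo z, f p - ∑ p ∈ primesUpTo y, f p := by
  rw [eq_sub_iff_add_eq, Finset.sum_sdiff]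
  intro p hp
  exact mem_primesUpTo.2 ((mem_primesUpTo.1 hp).trans h)

/-- A Chebyshev type bound for the sum of `1 / p ^ 2` over the primes above `y`. -/
theorem sum_one_div_sq_sdiff_le {y z : ℕ} (hy : 2 ≤ y) (h : y ≤ z) :
    ∑ p ∈ primesUpTo z \ primesUpTo y, 1 / ((p : ℕ) : ℝ) ^ 2 ≤
      2 * Real.log 4 / (y * Real.log y) := by
  have hlog : 0 < Real.log y := Real.log_pos (by exact_mod_cast hy)
  have hy0 : (0 : ℝ) < y := by positivity
  calc ∑ p ∈ primesUpTo z \ primesUpTo y, 1 / ((p : ℕ) : ℝ) ^ 2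
      ≤ ∑ p ∈ primesUpTo z \ primesUpTo y,
          1 / Real.log y * (Real.log (p : ℕ) / ((p : ℕ) : ℝ) ^ 2) := by
        refine Finset.sum_le_sum fun p hp => ?_
        rw [Finset.mem_sdiff, mem_primesUpTo, mem_primesUpTo, not_le] at hp
        have : Real.log y ≤ Real.log (p : ℕ) := Real.log_le_log hy0 (by exact_mod_cast hp.2.le)
        have h1 : 1 ≤ Real.log (p : ℕ) / Real.log y := by rwa [one_le_div hlog]
        calc 1 / ((p : ℕ) : ℝ) ^ 2 ≤ (Real.log (p : ℕ) / Real.log y) / ((p : ℕ) : ℝ) ^ 2 := by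
              gcongr
          _ = _ := by ring
    _ = 1 / Real.log y * ((∑ p ∈ primesLE z, Real.log p / (p : ℝ) ^ 2) -
          ∑ p ∈ primesLE y, Real.log p / (p : ℝ) ^ 2) := by
        rw [← Finset.mul_sum, sum_primesUpTo_sdiff h,
          sum_primesUpTo (fun p => Real.log p / (p : ℝ) ^ 2),
          sum_primesUpTo (fun p => Real.log p / (p : ℝ) ^ 2)]
    _ ≤ 1 / Real.log y * (2 * Real.log 4 / y) := by
        gcongr
        exact sum_log_div_sq_le (by omega) h
    _ = _ := by field_simp

end Mertens

/-! ### Identification of Mertens' constant with Euler's constant -/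

section MertensConstant

open Nat (primesLE)

theorem integrableOn_ite_exp_neg (c : ℝ) :
    IntegrableOn (fun x : ℝ => if c ≤ x then Real.exp (-x) else 0) (Set.Ioi 0) := by
  have h : (fun x : ℝ => if c ≤ x then Real.exp (-x) else 0) =
      (Set.Ici c).indicator fun x => Real.exp (-x) := by
    ext x; simp [Set.indicator_apply]
  rw [h]
  exact (integrableOn_exp_neg_Ioi 0).indicator measurableSet_Ici

theorem integral_ite_exp_neg {c : ℝ} (hc : 0 ≤ c) :
    ∫ x in Set.Ioi (0 : ℝ), (if c ≤ x then Real.exp (-x) else 0) = Real.exp (-c) := by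
  have h : (fun x : ℝ => if c ≤ x then Real.exp (-x) else 0) =
      (Set.Ici c).indicator fun x => Real.exp (-x) := by
    ext x; simp [Set.indicator_apply]
  rw [h, ← integral_Ici_eq_integral_Ioi, setIntegral_indicator measurableSet_Ici,
    Set.inter_eq_right.2 (Set.Ici_subset_Ici.2 hc), integral_Ici_eq_integral_Ioi,
    integral_exp_neg_Ioi]

/-- `∑_{p ≤ e ^ t} 1 / p - ∑_{n ≤ t} 1 / n`. -/
noncomputable def primeHarmonicDiff (t : ℝ) : ℝ :=
  (∑ p ∈ primesLE ⌊Real.exp t⌋₊, 1 / (p : ℝ)) - ∑ n ∈ Finset.range (⌊t⌋₊ + 1), 1 / (n : ℝ)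

theorem measurable_primeHarmonicDiff : Measurable primeHarmonicDiff := by
  have h1 : Measurable fun m : ℕ => ∑ p ∈ primesLE m, 1 / (p : ℝ) := measurable_from_nat
  have h2 : Measurable fun m : ℕ => ∑ n ∈ Finset.range (m + 1), 1 / (n : ℝ) := measurable_from_nat
  exact (h1.comp (Nat.measurable_floor.comp Real.measurable_exp)).sub
    (h2.comp Nat.measurable_floor)

theorem sum_range_one_div_eq_harmonic (n : ℕ) :
    ∑ k ∈ Finset.range (n + 1), 1 / (k : ℝ) = harmonic n := by
  rw [Finset.sum_range_succ', harmonic]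
  push_cast
  simp

/-- The cutoffs `exp t` for primes and `t` for integers make both sums grow like `log t`, leaving
the difference of their constants; the rest of the proof removes the two floors. -/
theorem tendsto_primeHarmonicDiff {c B : ℝ} (h : ∀ n : ℕ, 2 ≤ n →
      |(∑ p ∈ primesLE n, 1 / (p : ℝ)) - Real.log (Real.log n) - c| ≤ B / Real.log n) :
    Tendsto primeHarmonicDiff atTop (𝓝 (c - Real.eulerMascheroniConstant)) := by
  have hfl : Tendsto (fun t : ℝ => ⌊Real.exp t⌋₊) atTop atTop :=
    tendsto_nat_floor_atTop.comp Real.tendsto_exp_atTop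
  have h1 : Tendsto (fun n : ℕ => (∑ p ∈ primesLE n, 1 / (p : ℝ)) - Real.log (Real.log n)) atTop
      (𝓝 c) := by
    rw [tendsto_iff_norm_sub_tendsto_zero]
    refine squeeze_zero' (Eventually.of_forall fun _ => norm_nonneg _)
      ((eventually_ge_atTop 2).mono fun n hn => h n hn) ?_
    exact (Real.tendsto_log_atTop.comp tendsto_natCast_atTop_atTop).const_div_atTop B
  have h2 : Tendsto (fun n : ℕ => (∑ k ∈ Finset.range (n + 1), 1 / (k : ℝ)) - Real.log n) atTop
      (𝓝 Real.eulerMascheroniConstant) := by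
    simpa only [sum_range_one_div_eq_harmonic] using Real.tendsto_harmonic_sub_log
  have h3 : Tendsto (fun t : ℝ => (⌊t⌋₊ : ℝ) / t) atTop (𝓝 1) := tendsto_nat_floor_div_atTop
  have h4 : Tendsto (fun t : ℝ => Real.log ((⌊t⌋₊ : ℝ) / t)) atTop (𝓝 0) := by
    simpa using h3.log one_ne_zero
  have h5 : Tendsto (fun t : ℝ => Real.log ((⌊Real.exp t⌋₊ : ℝ) / Real.exp t)) atTop (𝓝 0) :=
    h4.comp Real.tendsto_exp_atTop
  have h6 : Tendsto (fun t : ℝ => Real.log ⌊Real.exp t⌋₊ / t) atTop (𝓝 1) := by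
    have : Tendsto (fun t : ℝ => 1 + Real.log ((⌊Real.exp t⌋₊ : ℝ) / Real.exp t) * t⁻¹) atTop
        (𝓝 (1 + 0 * 0)) := (h5.mul tendsto_inv_atTop_zero).const_add 1
    rw [mul_zero, add_zero] at this
    refine this.congr' ?_
    filter_upwards [eventually_gt_atTop 0] with t ht
    have hp : (0 : ℝ) < ⌊Real.exp t⌋₊ :=
      Nat.cast_pos.2 (Nat.floor_pos.2 (Real.one_le_exp ht.le))
    rw [Real.log_div hp.ne' (Real.exp_ne_zero _), Real.log_exp]
    field_simp
    ring
  have h7 : Tendsto (fun t : ℝ => Real.log (Real.log ⌊Real.exp t⌋₊ / t)) atTop (𝓝 0) := by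
    simpa using h6.log one_ne_zero
  have key := (((h1.comp hfl).sub (h2.comp tendsto_nat_floor_atTop)).add h7).sub h4
  rw [add_zero, sub_zero] at key
  refine key.congr' ?_
  filter_upwards [eventually_ge_atTop 2] with t ht
  have hp : (0 : ℝ) < ⌊t⌋₊ := Nat.cast_pos.2 (Nat.floor_pos.2 (by linarith))
  have hq : 0 < Real.log ⌊Real.exp t⌋₊ := by
    refine Real.log_pos ?_
    have h2e : (2 : ℝ) ≤ Real.exp t := by linarith [Real.add_one_le_exp t]
    exact_mod_cast Nat.le_floor (α := ℝ) (n := 2) (by exact_mod_cast h2e)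
  have ht0 : t ≠ 0 := by linarith
  simp only [Function.comp_apply, primeHarmonicDiff]
  rw [Real.log_div hp.ne' ht0, Real.log_div hq.ne' ht0]
  ring

theorem exists_abs_primeHarmonicDiff_le {l : ℝ} (h : Tendsto primeHarmonicDiff atTop (𝓝 l)) :
    ∃ K, ∀ t, |primeHarmonicDiff t| ≤ K := by
  obtain ⟨T, hT⟩ := (eventually_atTop.1
    (h.abs.eventually (ge_mem_nhds (lt_add_one |l|))))
  refine ⟨max (|l| + 1) ((∑ p ∈ primesLE ⌊Real.exp T⌋₊, 1 / (p : ℝ)) +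
    ∑ n ∈ Finset.range (⌊T⌋₊ + 1), 1 / (n : ℝ)), fun t => ?_⟩
  rcases le_total T t with ht | ht
  · exact (hT t ht).trans (le_max_left _ _)
  · refine le_trans ?_ (le_max_right _ _)
    refine (abs_sub _ _).trans ?_
    rw [abs_of_nonneg (Finset.sum_nonneg fun _ _ => by positivity),
      abs_of_nonneg (Finset.sum_nonneg fun _ _ => by positivity)]
    refine add_le_add ?_ ?_
    · refine Finset.sum_le_sum_of_subset_of_nonneg (fun p hp => ?_) fun _ _ _ => by positivity
      rw [Nat.mem_primesLE] at hp ⊢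
      exact ⟨hp.1.trans (Nat.floor_le_floor (Real.exp_le_exp.2 ht)), hp.2⟩
    · refine Finset.sum_le_sum_of_subset_of_nonneg (fun p hp => ?_) fun _ _ _ => by positivity
      have := Nat.floor_le_floor ht
      rw [Finset.mem_range] at hp ⊢
      omega

theorem summable_ite_prime_exp {δ : ℝ} (hδ : 0 < δ) :
    Summable fun n : ℕ => (if n.Prime then 1 / (n : ℝ) else 0) * Real.exp (-(δ * Real.log n)) := by
  refine Summable.of_nonneg_of_le (fun n => ?_) (fun n => ?_)
    (Real.summable_nat_rpow.2 (show -(1 + δ) < -1 by linarith))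
  · split_ifs <;> positivity
  · split_ifs with hn
    · have : (0 : ℝ) < n := by exact_mod_cast hn.pos
      rw [neg_add, Real.rpow_add this, Real.rpow_neg_one, one_div, Real.rpow_def_of_pos this]
      refine le_of_eq ?_
      ring_nf
    · rw [zero_mul]; positivity

theorem summable_one_div_mul_exp {δ : ℝ} (hδ : 0 < δ) :
    Summable fun n : ℕ => 1 / (n : ℝ) * Real.exp (-(δ * n)) := by
  have h := Real.summable_exp_nat_mul_iff.2 (show -δ < 0 by linarith)
  refine Summable.of_nonneg_of_le (fun n => by positivity) (fun n => ?_) h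
  rw [show (n : ℝ) * -δ = -(δ * n) by ring]
  refine mul_le_of_le_one_left (Real.exp_pos _).le ?_
  rcases Nat.eq_zero_or_pos n with rfl | hn
  · simp
  · rw [div_le_one (by exact_mod_cast hn)]
    exact_mod_cast hn

/-- Each weight is written as `exp(-c) = ∫_c^∞ exp(-x) dx`, with `c = δ log p` or `c = δ n`, and sum
and integral are exchanged. For fixed `x` the surviving terms are `p ≤ exp(x/δ)` and `n ≤ x/δ`. -/
theorem tsum_prime_sub_tsum_eq_integral {δ : ℝ} (hδ : 0 < δ) :
    (∑' n : ℕ, (if n.Prime then 1 / (n : ℝ) else 0) * Real.exp (-(δ * Real.log n))) -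
        ∑' n : ℕ, 1 / (n : ℝ) * Real.exp (-(δ * n)) =
      ∫ x in Set.Ioi (0 : ℝ), Real.exp (-x) * primeHarmonicDiff (x / δ) := by
  set a : ℕ → ℝ := fun n => if n.Prime then 1 / (n : ℝ) else 0 with ha
  have ha0 : ∀ n, 0 ≤ a n := fun n => by simp only [ha]; split_ifs <;> positivity
  set I : ℝ → ℝ → ℝ := fun c x => if c ≤ x then Real.exp (-x) else 0 with hI
  have hI0 : ∀ c x, 0 ≤ I c x := fun c x => by simp only [hI]; split_ifs <;> positivity
  set F : ℕ → ℝ → ℝ := fun n x =>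
    a n * I (δ * Real.log n) x - 1 / (n : ℝ) * I (δ * n) x with hF
  have hc1 : ∀ n : ℕ, 0 ≤ δ * Real.log n := fun n => mul_nonneg hδ.le (Real.log_natCast_nonneg n)
  have hc2 : ∀ n : ℕ, 0 ≤ δ * (n : ℝ) := fun n => by positivity
  have int1 : ∀ n : ℕ, IntegrableOn (fun x => a n * I (δ * Real.log n) x) (Set.Ioi 0) := fun n =>
    (integrableOn_ite_exp_neg _).const_mul _
  have int2 : ∀ n : ℕ, IntegrableOn (fun x => 1 / (n : ℝ) * I (δ * n) x) (Set.Ioi 0) := fun n =>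
    (integrableOn_ite_exp_neg _).const_mul _
  have val1 : ∀ n : ℕ, ∫ x in Set.Ioi (0 : ℝ), a n * I (δ * Real.log n) x =
      a n * Real.exp (-(δ * Real.log n)) := fun n => by
    rw [integral_const_mul, integral_ite_exp_neg (hc1 n)]
  have val2 : ∀ n : ℕ, ∫ x in Set.Ioi (0 : ℝ), 1 / (n : ℝ) * I (δ * n) x =
      1 / (n : ℝ) * Real.exp (-(δ * n)) := fun n => by
    rw [integral_const_mul, integral_ite_exp_neg (hc2 n)]
  have hs1 : Summable fun n => a n * Real.exp (-(δ * Real.log n)) := summable_ite_prime_exp hδ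
  have hs2 := summable_one_div_mul_exp hδ
  have hsum := hasSum_integral_of_summable_integral_norm (μ := volume.restrict (Set.Ioi (0 : ℝ)))
    (F := F) (fun n => (int1 n).sub (int2 n)) (by
      refine Summable.of_nonneg_of_le (fun n => integral_nonneg fun x => norm_nonneg _) (fun n => ?_)
        (hs1.add hs2)
      rw [← val1, ← val2, ← integral_add (int1 n) (int2 n)]
      refine integral_mono ((int1 n).sub (int2 n)).norm ((int1 n).add (int2 n)) fun x => ?_
      refine (norm_sub_le _ _).trans_eq ?_
      rw [Real.norm_of_nonneg (mul_nonneg (ha0 n) (hI0 _ _)),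
        Real.norm_of_nonneg (mul_nonneg (by positivity) (hI0 _ _))])
  rw [← hs1.tsum_sub hs2]
  have e1 : ∀ n : ℕ, ∫ x in Set.Ioi (0 : ℝ), F n x = a n * Real.exp (-(δ * Real.log n)) -
      1 / (n : ℝ) * Real.exp (-(δ * n)) := fun n => by
    simp only [hF]
    rw [integral_sub (int1 n) (int2 n), val1, val2]
  simp only [e1] at hsum
  rw [hsum.tsum_eq]
  refine setIntegral_congr_fun measurableSet_Ioi fun x hx => ?_
  have hx : 0 < x := hx
  have z1 : ∀ n ∉ primesLE ⌊Real.exp (x / δ)⌋₊, a n * I (δ * Real.log n) x = 0 := by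
    intro n hn
    simp only [ha, hI]
    split_ifs with h1 h2
    · refine absurd (Nat.mem_primesLE.2 ⟨Nat.le_floor ?_, h1⟩) hn
      rw [← Real.log_le_iff_le_exp (by exact_mod_cast h1.pos), le_div_iff₀ hδ]
      linarith
    all_goals simp
  have z2 : ∀ n ∉ Finset.range (⌊x / δ⌋₊ + 1), 1 / (n : ℝ) * I (δ * n) x = 0 := by
    intro n hn
    rw [Finset.mem_range, not_lt] at hn
    have h1 : x / δ < n := (Nat.floor_lt (by positivity)).1 hn
    rw [div_lt_iff₀ hδ] at h1
    simp only [hI]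
    rw [if_neg (by linarith), mul_zero]
  have s1 : Summable fun n => a n * I (δ * Real.log n) x := summable_of_ne_finset_zero z1
  have s2 : Summable fun n : ℕ => 1 / (n : ℝ) * I (δ * n) x := summable_of_ne_finset_zero z2
  simp only [hF]
  rw [s1.tsum_sub s2, tsum_eq_sum z1, tsum_eq_sum z2, primeHarmonicDiff, mul_sub, Finset.mul_sum,
    Finset.mul_sum]
  congr 1
  · refine Finset.sum_congr rfl fun p hp => ?_
    rw [Nat.mem_primesLE] at hp
    have h1 : δ * Real.log p ≤ x := by
      have : Real.log p ≤ x / δ := by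
        rw [Real.log_le_iff_le_exp (by exact_mod_cast hp.2.pos)]
        exact (Nat.le_floor_iff (Real.exp_pos _).le).1 hp.1
      rw [le_div_iff₀ hδ] at this
      linarith
    simp only [ha, hI]
    rw [if_pos hp.2, if_pos h1, mul_comm]
  · refine Finset.sum_congr rfl fun n hn => ?_
    rw [Finset.mem_range, Nat.lt_succ_iff, Nat.le_floor_iff (by positivity), le_div_iff₀ hδ] at hn
    simp only [hI]
    rw [if_pos (by linarith), mul_comm]

/-- An Abelian argument: for each `x > 0` the argument `x/δ` tends to infinity, and boundedness of
`primeHarmonicDiff` gives domination by a multiple of `exp(-x)`. -/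
theorem tendsto_integral_primeHarmonicDiff {l : ℝ} (h : Tendsto primeHarmonicDiff atTop (𝓝 l)) :
    Tendsto (fun δ : ℝ => ∫ x in Set.Ioi (0 : ℝ), Real.exp (-x) * primeHarmonicDiff (x / δ))
      (𝓝[>] 0) (𝓝 l) := by
  obtain ⟨K, hK⟩ := exists_abs_primeHarmonicDiff_le h
  have e : l = ∫ x in Set.Ioi (0 : ℝ), Real.exp (-x) * l := by
    rw [integral_mul_const, integral_exp_neg_Ioi]; simp
  conv in 𝓝 l => rw [e]
  refine tendsto_integral_filter_of_dominated_convergence (fun x => Real.exp (-x) * K) ?_ ?_ ?_ ?_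
  · refine Eventually.of_forall fun δ => Measurable.aestronglyMeasurable ?_
    exact (Real.measurable_exp.comp measurable_neg).mul
      (measurable_primeHarmonicDiff.comp (measurable_id.div_const δ))
  · refine Eventually.of_forall fun δ => Eventually.of_forall fun x => ?_
    rw [norm_mul, Real.norm_of_nonneg (Real.exp_pos _).le]
    gcongr
    exact hK _
  · exact (integrableOn_exp_neg_Ioi 0).mul_const K
  · refine (ae_restrict_mem measurableSet_Ioi).mono fun x hx => ?_
    refine (h.comp (f := fun δ : ℝ => x / δ) ?_).const_mul _
    simp only [div_eq_mul_inv]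
    exact tendsto_inv_nhdsGT_zero.const_mul_atTop hx

theorem tsum_one_div_mul_exp {δ : ℝ} (hδ : 0 < δ) :
    ∑' n : ℕ, 1 / (n : ℝ) * Real.exp (-(δ * n)) = -Real.log (1 - Real.exp (-δ)) := by
  have h1 : |Real.exp (-δ)| < 1 := by
    rw [abs_of_pos (Real.exp_pos _), Real.exp_lt_one_iff]; linarith
  rw [← (Real.hasSum_pow_div_log_of_abs_lt_one h1).tsum_eq,
    (summable_one_div_mul_exp hδ).tsum_eq_zero_add]
  simp only [Nat.cast_zero, div_zero, zero_mul, zero_add]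
  refine tsum_congr fun n => ?_
  rw [← Real.exp_nat_mul, mul_comm, mul_one_div]
  congr 2
  · ring
  · push_cast; ring

theorem tendsto_log_one_sub_exp_sub_log :
    Tendsto (fun δ : ℝ => Real.log (1 - Real.exp (-δ)) - Real.log δ) (𝓝[>] 0) (𝓝 0) := by
  have h : HasDerivAt (fun δ : ℝ => -Real.exp (-δ)) 1 0 := by
    simpa using ((hasDerivAt_id' (0 : ℝ)).fun_neg.exp).fun_neg
  have h1 := h.tendsto_slope_zero_right
  have h2 : Tendsto (fun δ : ℝ => Real.log ((1 - Real.exp (-δ)) / δ)) (𝓝[>] 0) (𝓝 0) := by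
    rw [show 𝓝 (0 : ℝ) = 𝓝 (Real.log 1) by rw [Real.log_one]]
    refine Tendsto.log (h1.congr fun δ => ?_) one_ne_zero
    simp only [zero_add, neg_zero, Real.exp_zero, smul_eq_mul]
    ring
  refine h2.congr' ?_
  filter_upwards [self_mem_nhdsWithin] with δ hδ
  have hδ : 0 < δ := hδ
  have : Real.exp (-δ) < 1 := by rw [Real.exp_lt_one_iff]; linarith
  rw [Real.log_div (by linarith) hδ.ne']

/-- The remainder `-log (1 - x) - x`. -/
noncomputable def logRemainder (x : ℝ) : ℝ := -Real.log (1 - x) - x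

theorem abs_logRemainder_le {x : ℝ} (h0 : 0 ≤ x) (h1 : x ≤ 1 / 2) :
    |logRemainder x| ≤ 2 * x ^ 2 := by
  have h := Real.abs_log_sub_add_sum_range_le (x := x) (by rw [abs_of_nonneg h0]; linarith) 1
  rw [abs_of_nonneg h0] at h
  simp only [Finset.range_one, Finset.sum_singleton, zero_add, pow_one, Nat.cast_zero,
    div_one, Nat.reduceAdd] at h
  rw [logRemainder, abs_sub_comm, sub_neg_eq_add]
  refine h.trans ?_
  rw [div_le_iff₀ (by linarith)]
  nlinarith [sq_nonneg x]

theorem one_div_prime_le_half (p : Nat.Primes) : 1 / ((p : ℕ) : ℝ) ≤ 1 / 2 :=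
  one_div_le_one_div_of_le two_pos (by exact_mod_cast p.2.two_le)

theorem Nat.Primes.cast_pos (p : Nat.Primes) : (0 : ℝ) < ((p : ℕ) : ℝ) := by
  exact_mod_cast p.2.pos

theorem summable_two_mul_one_div_primes_sq :
    Summable fun p : Nat.Primes => 2 * (1 / ((p : ℕ) : ℝ)) ^ 2 := by
  have h := (Nat.Primes.summable_rpow (r := -2)).2 (by norm_num)
  refine (h.mul_left 2).congr fun p => ?_
  rw [Real.rpow_neg p.cast_pos.le, one_div, inv_pow]
  norm_cast

theorem rpow_neg_one_sub_le {δ : ℝ} (hδ : 0 ≤ δ) (p : Nat.Primes) :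
    ((p : ℕ) : ℝ) ^ (-(1 + δ)) ≤ 1 / ((p : ℕ) : ℝ) := by
  rw [one_div, ← Real.rpow_neg_one]
  exact Real.rpow_le_rpow_of_exponent_le (by exact_mod_cast p.2.one_le) (by linarith)

theorem summable_primes_rpow {δ : ℝ} (hδ : 0 < δ) :
    Summable fun p : Nat.Primes => ((p : ℕ) : ℝ) ^ (-(1 + δ)) :=
  Nat.Primes.summable_rpow.2 (by linarith)

theorem abs_logRemainder_rpow_le {δ : ℝ} (hδ : 0 ≤ δ) (p : Nat.Primes) :
    |logRemainder (((p : ℕ) : ℝ) ^ (-(1 + δ)))| ≤ 2 * (1 / ((p : ℕ) : ℝ)) ^ 2 := by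
  have h0 : 0 ≤ ((p : ℕ) : ℝ) ^ (-(1 + δ)) := by positivity
  refine (abs_logRemainder_le h0 ((rpow_neg_one_sub_le hδ p).trans
    (one_div_prime_le_half p))).trans ?_
  gcongr
  exact rpow_neg_one_sub_le hδ p

theorem exp_tsum_primes_eq_norm_zeta {δ : ℝ} (hδ : 0 < δ) :
    Real.exp ((∑' p : Nat.Primes, ((p : ℕ) : ℝ) ^ (-(1 + δ))) +
      ∑' p : Nat.Primes, logRemainder (((p : ℕ) : ℝ) ^ (-(1 + δ)))) =
      ‖riemannZeta (1 + δ : ℝ)‖ := by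
  rw [← riemannZeta_eulerProduct_exp_log (by simpa using hδ), Complex.norm_exp,
    ← (summable_primes_rpow hδ).tsum_add (Summable.of_norm_bounded
      summable_two_mul_one_div_primes_sq fun p => abs_logRemainder_rpow_le hδ.le p)]
  congr 1
  rw [← Complex.ofReal_re (∑' p : Nat.Primes, _), Complex.ofReal_tsum]
  congr 1
  refine tsum_congr fun p => ?_
  have h1 := (rpow_neg_one_sub_le hδ.le p).trans (one_div_prime_le_half p)
  rw [logRemainder, add_sub_cancel, Complex.ofReal_neg, Complex.ofReal_log (by linarith),
    Complex.ofReal_sub, Complex.ofReal_cpow p.cast_pos.le]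
  simp

theorem tendsto_log_norm_zeta_add_log :
    Tendsto (fun δ : ℝ => Real.log ‖riemannZeta (1 + δ : ℝ)‖ + Real.log δ) (𝓝[>] 0) (𝓝 0) := by
  have h1 : Tendsto (fun δ : ℝ => ((1 + δ : ℝ) : ℂ)) (𝓝[>] 0) (𝓝[≠] 1) := by
    refine tendsto_nhdsWithin_iff.2 ⟨?_, ?_⟩
    · have : Continuous fun δ : ℝ => ((1 + δ : ℝ) : ℂ) := by fun_prop
      have h := this.tendsto 0
      simp only [add_zero, Complex.ofReal_one] at h
      exact h.mono_left nhdsWithin_le_nhds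
    · filter_upwards [self_mem_nhdsWithin] with δ hδ
      have hδ : 0 < δ := hδ
      simpa using hδ.ne'
  have h2 := ((riemannZeta_residue_one.comp h1).norm).log (by simp)
  simp only [norm_one, Real.log_one] at h2
  refine h2.congr' ?_
  filter_upwards [self_mem_nhdsWithin] with δ hδ
  have hδ : 0 < δ := hδ
  have hz : riemannZeta ((1 + δ : ℝ) : ℂ) ≠ 0 :=
    riemannZeta_ne_zero_of_one_le_re (by simpa using hδ.le)
  simp only [Function.comp_apply]
  have e : ((1 + δ : ℝ) : ℂ) - 1 = (δ : ℂ) := by push_cast; ring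
  rw [e, norm_mul, Complex.norm_real, Real.norm_of_nonneg hδ.le,
    Real.log_mul hδ.ne' (norm_ne_zero_iff.2 hz), add_comm]

theorem tendsto_tsum_logRemainder :
    Tendsto (fun δ : ℝ => ∑' p : Nat.Primes, logRemainder (((p : ℕ) : ℝ) ^ (-(1 + δ))))
      (𝓝[>] 0) (𝓝 (∑' p : Nat.Primes, logRemainder (1 / ((p : ℕ) : ℝ)))) := by
  refine tendsto_tsum_of_dominated_convergence summable_two_mul_one_div_primes_sq (fun p => ?_) ?_
  · have h1 : Tendsto (fun δ : ℝ => ((p : ℕ) : ℝ) ^ (-(1 + δ))) (𝓝[>] 0)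
        (𝓝 (1 / ((p : ℕ) : ℝ))) := by
      have : Continuous fun δ : ℝ => ((p : ℕ) : ℝ) ^ (-(1 + δ)) :=
        Continuous.rpow continuous_const (by fun_prop) fun _ => Or.inl p.cast_pos.ne'
      have h := this.tendsto 0
      rw [add_zero, Real.rpow_neg_one, ← one_div] at h
      exact h.mono_left nhdsWithin_le_nhds
    have h2 := one_div_prime_le_half p
    refine ((h1.const_sub 1).log (by linarith)).neg.sub h1
  · filter_upwards [self_mem_nhdsWithin] with δ hδ p
    exact abs_logRemainder_rpow_le (le_of_lt hδ) p

/-- Two evaluations of `∑ p^(-1-δ) + log δ` as `δ → 0+`. Comparison with `∑ exp(-δn)/n = -log(1 -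
exp(-δ))` gives the limit `c - γ`; the Euler product and the residue of zeta at `1` give minus the
sum of the remainders. -/
theorem mertens_constant {c B : ℝ} (h : ∀ n : ℕ, 2 ≤ n →
      |(∑ p ∈ primesLE n, 1 / (p : ℝ)) - Real.log (Real.log n) - c| ≤ B / Real.log n) :
    c + ∑' p : Nat.Primes, logRemainder (1 / ((p : ℕ) : ℝ)) = Real.eulerMascheroniConstant := by
  have h1 := (tendsto_integral_primeHarmonicDiff (tendsto_primeHarmonicDiff h)).sub
    tendsto_log_one_sub_exp_sub_log
  have h2 := tendsto_log_norm_zeta_add_log.sub tendsto_tsum_logRemainder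
  have h3 := tendsto_nhds_unique h1 (h2.congr' ?_)
  · linarith
  filter_upwards [self_mem_nhdsWithin] with δ hδ
  have hδ : 0 < δ := hδ
  rw [← exp_tsum_primes_eq_norm_zeta hδ, Real.log_exp, ← tsum_prime_sub_tsum_eq_integral hδ,
    tsum_one_div_mul_exp hδ]
  have e : ∑' p : Nat.Primes, ((p : ℕ) : ℝ) ^ (-(1 + δ)) =
      ∑' n : ℕ, (if n.Prime then 1 / (n : ℝ) else 0) * Real.exp (-(δ * Real.log n)) := by
    have e1 := tsum_subtype {p : ℕ | p.Prime} fun p : ℕ => (p : ℝ) ^ (-(1 + δ))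
    refine Eq.trans e1 (tsum_congr fun n => ?_)
    rw [Set.indicator_apply]
    simp only [Set.mem_ofPred_eq]
    split_ifs with hn
    · have : (0 : ℝ) < n := by exact_mod_cast hn.pos
      rw [neg_add, Real.rpow_add this, Real.rpow_neg_one, one_div, Real.rpow_def_of_pos this]
      ring_nf
    · simp
  rw [e]
  ring

theorem tendsto_primesUpTo : Tendsto primesUpTo atTop atTop := by
  refine tendsto_atTop_finset_of_monotone (fun y z h p hp => ?_) fun p => ⟨p, ?_⟩
  · exact mem_primesUpTo.2 ((mem_primesUpTo.1 hp).trans h)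
  · exact mem_primesUpTo.2 le_rfl

/-- **Mertens' second and third theorems**. -/
theorem exists_mertens :
    ∃ C : ℝ, 0 < C ∧ ∀ n : ℕ, 2 ≤ n →
      |(∑ p ∈ primesUpTo n, 1 / ((p : ℕ) : ℝ)) - Real.log (Real.log n)| ≤ C ∧
      |(∑ p ∈ primesUpTo n, -Real.log (1 - 1 / ((p : ℕ) : ℝ))) - Real.log (Real.log n) -
        Real.eulerMascheroniConstant| ≤ C / Real.log n := by
  obtain ⟨c, B, hB0, hB⟩ := exists_abs_sum_one_div_sub_log_log_le
  have hl2 : 0 < Real.log 2 := Real.log_pos one_lt_two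
  have hl4 : 0 < Real.log 4 := Real.log_pos (by norm_num)
  refine ⟨max (|c| + B / Real.log 2) (B + 2 * Real.log 4) + 1,
    by have : 0 ≤ |c| + B / Real.log 2 := by positivity
       have := le_max_left (|c| + B / Real.log 2) (B + 2 * Real.log 4)
       linarith, fun n hn => ?_⟩
  have hn2 : (2 : ℝ) ≤ n := by exact_mod_cast hn
  have hlog2 : Real.log 2 ≤ Real.log n := Real.log_le_log two_pos hn2
  have hlog : 0 < Real.log n := hl2.trans_le hlog2
  have h1 := hB n hn
  rw [← sum_primesUpTo (fun p => 1 / (p : ℝ))] at h1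
  constructor
  · have h2 : B / Real.log n ≤ B / Real.log 2 := by gcongr
    have h3 := le_max_left (|c| + B / Real.log 2) (B + 2 * Real.log 4)
    have e : (∑ p ∈ primesUpTo n, 1 / ((p : ℕ) : ℝ)) - Real.log (Real.log n) =
      ((∑ p ∈ primesUpTo n, 1 / ((p : ℕ) : ℝ)) - Real.log (Real.log n) - c) + c := by ring
    rw [e]
    refine (abs_add_le _ _).trans ?_
    linarith
  · have hsum : Summable fun p : Nat.Primes => logRemainder (1 / ((p : ℕ) : ℝ)) :=
      Summable.of_norm_bounded summable_two_mul_one_div_primes_sq fun p =>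
        abs_logRemainder_le (by positivity) (one_div_prime_le_half p)
    have htail : |(∑' p : Nat.Primes, logRemainder (1 / ((p : ℕ) : ℝ))) -
        ∑ p ∈ primesUpTo n, logRemainder (1 / ((p : ℕ) : ℝ))| ≤ 2 * Real.log 4 / Real.log n := by
      have hlim := ((hsum.hasSum.comp tendsto_primesUpTo).sub_const
        (∑ p ∈ primesUpTo n, logRemainder (1 / ((p : ℕ) : ℝ)))).abs
      refine le_of_tendsto hlim ((eventually_ge_atTop n).mono fun z hz => ?_)
      simp only [Function.comp_apply]
      rw [← sum_primesUpTo_sdiff hz]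
      refine (Finset.abs_sum_le_sum_abs _ _).trans ?_
      calc _ ≤ ∑ p ∈ primesUpTo z \ primesUpTo n, 2 * (1 / ((p : ℕ) : ℝ) ^ 2) := by
            refine Finset.sum_le_sum fun p _ => ?_
            have := abs_logRemainder_le (x := 1 / ((p : ℕ) : ℝ)) (by positivity)
              (one_div_prime_le_half p)
            rwa [one_div_pow] at this
        _ ≤ 2 * (2 * Real.log 4 / (n * Real.log n)) := by
            rw [← Finset.mul_sum]
            gcongr
            exact sum_one_div_sq_sdiff_le hn hz
        _ = (2 / n) * (2 * Real.log 4 / Real.log n) := by field_simp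
        _ ≤ _ := mul_le_of_le_one_left (by positivity) ((div_le_one (by positivity)).2 hn2)
    have hc := mertens_constant hB
    have e : (∑ p ∈ primesUpTo n, -Real.log (1 - 1 / ((p : ℕ) : ℝ))) =
        (∑ p ∈ primesUpTo n, 1 / ((p : ℕ) : ℝ)) +
          ∑ p ∈ primesUpTo n, logRemainder (1 / ((p : ℕ) : ℝ)) := by
      rw [← Finset.sum_add_distrib]
      exact Finset.sum_congr rfl fun p _ => by rw [logRemainder]; ring
    rw [e, ← hc]
    have e2 : (∑ p ∈ primesUpTo n, 1 / ((p : ℕ) : ℝ)) +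
          ∑ p ∈ primesUpTo n, logRemainder (1 / ((p : ℕ) : ℝ)) - Real.log (Real.log n) -
          (c + ∑' p : Nat.Primes, logRemainder (1 / ((p : ℕ) : ℝ))) =
        ((∑ p ∈ primesUpTo n, 1 / ((p : ℕ) : ℝ)) - Real.log (Real.log n) - c) -
        ((∑' p : Nat.Primes, logRemainder (1 / ((p : ℕ) : ℝ))) -
          ∑ p ∈ primesUpTo n, logRemainder (1 / ((p : ℕ) : ℝ))) := by ring
    rw [e2]
    refine (abs_sub _ _).trans ((add_le_add h1 htail).trans ?_)
    rw [← add_div]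
    refine div_le_div_of_nonneg_right ?_ hlog.le
    have h3 := le_max_right (|c| + B / Real.log 2) (B + 2 * Real.log 4)
    linarith

end MertensConstant

/-! ### The uniform law on the circle -/

section CircleUniform

theorem measurable_exp_mul_I : Measurable fun t : ℝ => Complex.exp (t * Complex.I) := by
  fun_prop

theorem volume_Ioc_neg_pi_pi : volume (Set.Ioc (-Real.pi) Real.pi) = ENNReal.ofReal (2 * Real.pi) := by
  rw [Real.volume_Ioc]; ring_nf

theorem isProbabilityMeasure_cond_Ioc :
    IsProbabilityMeasure (volume[|Set.Ioc (-Real.pi) Real.pi]) := by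
  refine cond_isProbabilityMeasure_of_finite ?_ ?_
  · rw [volume_Ioc_neg_pi_pi, Ne, ENNReal.ofReal_eq_zero, not_le]; positivity
  · rw [volume_Ioc_neg_pi_pi]; exact ENNReal.ofReal_ne_top

instance : IsProbabilityMeasure circleUniform := by
  have := isProbabilityMeasure_cond_Ioc
  exact Measure.isProbabilityMeasure_map measurable_exp_mul_I.aemeasurable

theorem ae_norm_eq_one_circleUniform : ∀ᵐ w ∂circleUniform, ‖w‖ = 1 := by
  rw [circleUniform, ae_map_iff measurable_exp_mul_I.aemeasurable
    (measurableSet_eq_fun measurable_norm measurable_const)]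
  exact Eventually.of_forall fun t => Complex.norm_exp_ofReal_mul_I t

theorem integral_id_circleUniform : ∫ w, w ∂circleUniform = 0 := by
  rw [circleUniform, integral_map (f := fun w : ℂ => w) measurable_exp_mul_I.aemeasurable
    measurable_id.aestronglyMeasurable, ProbabilityTheory.cond, integral_smul_measure,
    ← intervalIntegral.integral_of_le (by linarith [Real.pi_pos])]
  have h := integral_exp_mul_complex (a := -Real.pi) (b := Real.pi) (c := Complex.I)
    Complex.I_ne_zero
  have e : ∀ t : ℝ, (t : ℂ) * Complex.I = Complex.I * t := fun t => mul_comm _ _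
  simp only [e]
  rw [h]
  have : Complex.exp (Complex.I * (Real.pi : ℝ)) = Complex.exp (Complex.I * (-Real.pi : ℝ)) := by
    rw [mul_comm, Complex.exp_pi_mul_I, mul_comm, Complex.ofReal_neg, neg_mul, Complex.exp_neg,
      Complex.exp_pi_mul_I]
    norm_num
  rw [this, sub_self, zero_div, smul_zero]

/-- The mass of an arc of half-width `ε` around `exp (i α)`. -/
theorem le_circleUniform_arc {α ε : ℝ} (h1 : -Real.pi < α - ε) (h2 : α + ε ≤ Real.pi) :
    ENNReal.ofReal (ε / Real.pi) ≤ circleUniform {w | w.arg ∈ Set.Icc (α - ε) (α + ε)} := by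
  have hD : MeasurableSet {w : ℂ | w.arg ∈ Set.Icc (α - ε) (α + ε)} :=
    Complex.measurable_arg measurableSet_Icc
  rw [circleUniform, Measure.map_apply measurable_exp_mul_I hD, cond_apply measurableSet_Ioc,
    volume_Ioc_neg_pi_pi]
  have hsub : Set.Icc (α - ε) (α + ε) ⊆ Set.Ioc (-Real.pi) Real.pi ∩
      (fun t : ℝ => Complex.exp (t * Complex.I)) ⁻¹'
        {w : ℂ | w.arg ∈ Set.Icc (α - ε) (α + ε)} := by
    intro t ht
    have ht' : t ∈ Set.Ioc (-Real.pi) Real.pi := ⟨h1.trans_le ht.1, ht.2.trans h2⟩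
    refine ⟨ht', ?_⟩
    simp only [Set.mem_preimage, Set.mem_ofPred_eq, Complex.arg_exp_mul_I]
    have e : -Real.pi + 2 * Real.pi = Real.pi := by ring
    rwa [(toIocMod_eq_self Real.two_pi_pos).2 (by rwa [e])]
  have hv : volume (Set.Icc (α - ε) (α + ε)) = ENNReal.ofReal (2 * ε) := by
    rw [Real.volume_Icc]; ring_nf
  calc ENNReal.ofReal (ε / Real.pi)
      = (ENNReal.ofReal (2 * Real.pi))⁻¹ * ENNReal.ofReal (2 * ε) := by
        rw [← ENNReal.ofReal_inv_of_pos (by positivity), ← ENNReal.ofReal_mul (by positivity)]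
        congr 1
        field_simp
    _ ≤ _ := by
        rw [← hv]
        gcongr

end CircleUniform

/-! ### Exponential moments and almost sure convergence of `∑ X(p)/p` -/

section Steinhaus

variable {Ω : Type*} [MeasurableSpace Ω] {P : Measure Ω} {X : Nat.Primes → Ω → ℂ}

/-- The law gives only almost everywhere measurability and modulus one. Changing each of the
countably many variables on a null set makes both hold everywhere, without altering the
probabilities. -/
theorem IsSteinhaus.exists_normalized (h : IsSteinhaus P X) :
    ∃ X' : Nat.Primes → Ω → ℂ, IsSteinhaus P X' ∧ (∀ p, Measurable (X' p)) ∧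
      (∀ p ω, ‖X' p ω‖ = 1) ∧ ∀ᵐ ω ∂P, ∀ p, X p ω = X' p ω := by
  have hae : ∀ p, AEMeasurable (X p) P := fun p => (h.law p).aemeasurable
  set Y : Nat.Primes → Ω → ℂ := fun p => (hae p).mk (X p) with hY
  have hYm : ∀ p, Measurable (Y p) := fun p => (hae p).measurable_mk
  have hXY : ∀ p, X p =ᵐ[P] Y p := fun p => (hae p).ae_eq_mk
  have hnorm : ∀ p, ∀ᵐ ω ∂P, ‖X p ω‖ = 1 := fun p =>
    ((h.law p).ae_iff (p := fun w => ‖w‖ = 1)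
      (measurable_norm.eq measurable_const)).2 ae_norm_eq_one_circleUniform
  have heq : ∀ p, X p =ᵐ[P] fun ω => if ‖Y p ω‖ = 1 then Y p ω else 1 := fun p => by
    filter_upwards [hXY p, hnorm p] with ω h1 h2
    rw [← h1, if_pos h2]
  refine ⟨fun p ω => if ‖Y p ω‖ = 1 then Y p ω else 1, ⟨fun p => ?_, ?_⟩, fun p => ?_,
    fun p ω => ?_, ae_all_iff.2 heq⟩
  · exact (h.law p).congr (heq p).symm
  · exact h.indep.congr heq
  · exact Measurable.ite (measurableSet_eq_fun (hYm p).norm measurable_const) (hYm p)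
      measurable_const
  · dsimp only
    split_ifs with h1
    · exact h1
    · exact norm_one

theorem IsSteinhaus.integral_eq_zero (h : IsSteinhaus P X) (p : Nat.Primes) :
    ∫ ω, X p ω ∂P = 0 := by
  rw [(h.law p).integral_eq, integral_id_circleUniform]

theorem IsSteinhaus.integral_re_mul (h : IsSteinhaus P X) [IsProbabilityMeasure P]
    (hm : ∀ p, Measurable (X p)) (hn : ∀ p ω, ‖X p ω‖ = 1) (u : ℂ) (p : Nat.Primes) :
    ∫ ω, (u * X p ω).re ∂P = 0 := by
  have hint : Integrable (X p) P :=
    Integrable.of_bound (hm p).aestronglyMeasurable 1 (Eventually.of_forall fun ω => (hn p ω).le)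
  have := integral_re (hint.const_mul u)
  simp only [RCLike.re_to_complex] at this
  rw [this, integral_const_mul, h.integral_eq_zero, mul_zero, Complex.zero_re]

/-- Hoeffding's lemma: `Re(u X(p))` has mean zero and lies in `[-‖u‖, ‖u‖]`. -/
theorem IsSteinhaus.lintegral_exp_le (h : IsSteinhaus P X) [IsProbabilityMeasure P]
    (hm : ∀ p, Measurable (X p)) (hn : ∀ p ω, ‖X p ω‖ = 1) (u : ℂ) (p : Nat.Primes) :
    ∫⁻ ω, ENNReal.ofReal (Real.exp (u * X p ω).re) ∂P ≤
      ENNReal.ofReal (Real.exp (‖u‖ ^ 2 / 2)) := by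
  have hmeas : Measurable fun ω => (u * X p ω).re :=
    Complex.measurable_re.comp ((hm p).const_mul u)
  have hs := hasSubgaussianMGF_of_mem_Icc_of_integral_eq_zero (μ := P) (a := -‖u‖) (b := ‖u‖)
    hmeas.aemeasurable (Eventually.of_forall fun ω => by
      rw [Set.mem_Icc, ← abs_le]
      refine (Complex.abs_re_le_norm _).trans_eq ?_
      rw [norm_mul, hn, mul_one]) (h.integral_re_mul hm hn u p)
  have hi := hs.integrable_exp_mul 1
  have hg := hs.mgf_le 1
  simp only [mgf, one_mul] at hi hg
  rw [← ofReal_integral_eq_lintegral_ofReal hi (Eventually.of_forall fun ω => (Real.exp_pos _).le)]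
  refine ENNReal.ofReal_le_ofReal (hg.trans_eq ?_)
  congr 1
  simp only [one_pow, mul_one, NNReal.coe_pow, NNReal.coe_div, coe_nnnorm]
  rw [sub_neg_eq_add, Real.norm_of_nonneg (by positivity)]
  norm_num

/-- The exponential moment of a sum of the `X p / p`, on an event that depends only on the `X p`
with `p` in a disjoint set. -/
theorem IsSteinhaus.setLIntegral_exp_sum_le (h : IsSteinhaus P X) [IsProbabilityMeasure P]
    (hm : ∀ p, Measurable (X p)) (hn : ∀ p ω, ‖X p ω‖ = 1) {D : Set ℂ} (hD : MeasurableSet D)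
    (u : ℂ) {t s : Finset Nat.Primes} (hts : Disjoint t s) :
    ∫⁻ ω in {ω | ∀ p ∈ t, X p ω ∈ D},
        ENNReal.ofReal (Real.exp (u * ∑ p ∈ s, X p ω / (p : ℕ)).re) ∂P ≤
      P {ω | ∀ p ∈ t, X p ω ∈ D} *
        ENNReal.ofReal (Real.exp (‖u‖ ^ 2 / 2 * ∑ p ∈ s, 1 / ((p : ℕ) : ℝ) ^ 2)) := by
  classical
  -- A single family carries both the indicators on `t` and the exponentials on `s`, so independence
  -- factors their joint product at once.
  set f : Nat.Primes → ℂ → ENNReal := fun p => if p ∈ t then D.indicator 1 else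
    fun w => ENNReal.ofReal (Real.exp (u / (p : ℕ) * w).re) with hf
  have hfm : ∀ p, Measurable (f p) := fun p => by
    simp only [hf]
    split_ifs
    · exact measurable_one.indicator hD
    · exact ENNReal.measurable_ofReal.comp (Real.measurable_exp.comp
        (Complex.measurable_re.comp (measurable_id.const_mul _)))
  have hind : iIndepFun (fun p ω => f p (X p ω)) P := h.indep.comp f hfm
  have hprod := fun s : Finset Nat.Primes => lintegral_prod_eq_prod_lintegral_of_indepFun s
    (fun p ω => f p (X p ω)) hind fun p => (hfm p).comp (hm p)
  set B : Set Ω := {ω | ∀ p ∈ t, X p ω ∈ D} with hB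
  have hBm : MeasurableSet B := by
    have : B = ⋂ p ∈ t, X p ⁻¹' D := by ext ω; simp [hB]
    rw [this]
    exact Finset.measurableSet_biInter t fun p _ => hm p hD
  have hfB : ∀ ω, ∏ p ∈ t, f p (X p ω) = B.indicator 1 ω := fun ω => by
    by_cases hω : ω ∈ B
    · rw [Set.indicator_of_mem hω, Pi.one_apply]
      refine Finset.prod_eq_one fun p hp => ?_
      simp only [hf, if_pos hp]
      rw [Set.indicator_of_mem (hω p hp), Pi.one_apply]
    · rw [Set.indicator_of_notMem hω]
      simp only [hB, Set.mem_ofPred_eq, not_forall] at hω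
      obtain ⟨p, hp, hpD⟩ := hω
      refine Finset.prod_eq_zero hp ?_
      simp only [hf, if_pos hp]
      rw [Set.indicator_of_notMem hpD]
  have hfs : ∀ ω, ∏ p ∈ s, f p (X p ω) =
      ENNReal.ofReal (Real.exp (u * ∑ p ∈ s, X p ω / (p : ℕ)).re) := fun ω => by
    rw [Finset.mul_sum, Complex.re_sum, Real.exp_sum, ENNReal.ofReal_prod_of_nonneg
      fun p _ => (Real.exp_pos _).le]
    refine Finset.prod_congr rfl fun p hp => ?_
    simp only [hf, if_neg (Finset.disjoint_right.1 hts hp)]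
    congr 3
    ring
  have hPB : P B = ∏ p ∈ t, ∫⁻ ω, f p (X p ω) ∂P := by
    rw [← hprod t]
    simp only [hfB]
    rw [lintegral_indicator_one hBm]
  calc ∫⁻ ω in B, ENNReal.ofReal (Real.exp (u * ∑ p ∈ s, X p ω / (p : ℕ)).re) ∂P
      = ∫⁻ ω, ∏ p ∈ t ∪ s, f p (X p ω) ∂P := by
        rw [← lintegral_indicator hBm]
        refine lintegral_congr fun ω => ?_
        rw [Finset.prod_union hts, hfB, hfs]
        by_cases hω : ω ∈ B <;> simp [hω]
    _ = P B * ∏ p ∈ s, ∫⁻ ω, f p (X p ω) ∂P := by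
        rw [hprod, Finset.prod_union hts, hPB]
    _ ≤ P B * ∏ p ∈ s, ENNReal.ofReal (Real.exp (‖u / (p : ℕ)‖ ^ 2 / 2)) := by
        gcongr with p hp
        simp only [hf, if_neg (Finset.disjoint_right.1 hts hp)]
        exact h.lintegral_exp_le hm hn _ p
    _ = _ := by
        rw [← ENNReal.ofReal_prod_of_nonneg fun p _ => (Real.exp_pos _).le, ← Real.exp_sum,
          Finset.mul_sum]
        congr 3
        refine Finset.sum_congr rfl fun p _ => ?_
        rw [norm_div, Complex.norm_natCast]
        ring

theorem primesUpTo_succ_of_prime {y : ℕ} {q : Nat.Primes} (h : (q : ℕ) = y + 1) :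
    primesUpTo (y + 1) = Finset.cons q (primesUpTo y)
      fun hp => Nat.not_succ_le_self y (h.symm.trans_le (mem_primesUpTo.1 hp)) := by
  ext p
  rw [Finset.mem_cons, mem_primesUpTo, mem_primesUpTo]
  constructor
  · intro hp
    rcases Nat.le_succ_iff.1 hp with h1 | h1
    · exact Or.inr h1
    · exact Or.inl (Subtype.ext (h1.trans h.symm))
  · rintro (rfl | h1)
    · exact h.le
    · exact h1.trans (Nat.le_succ y)

theorem primesUpTo_succ_of_not_prime {y : ℕ} (h : ¬(y + 1).Prime) :
    primesUpTo (y + 1) = primesUpTo y := by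
  ext p
  rw [mem_primesUpTo, mem_primesUpTo]
  refine ⟨fun hp => ?_, fun hp => hp.trans (Nat.le_succ y)⟩
  rcases Nat.le_succ_iff.1 hp with h1 | h1
  · exact h1
  · have hp2 := p.2
    rw [h1] at hp2
    exact absurd hp2 h

/-- The filtration generated by a family of random variables indexed by the primes. -/
def primeFiltration (Y : Nat.Primes → Ω → ℝ) (hm : ∀ p, Measurable (Y p)) :
    Filtration ℕ (inferInstance : MeasurableSpace Ω) where
  seq y := ⨆ p ∈ {p : Nat.Primes | (p : ℕ) ≤ y}, MeasurableSpace.comap (Y p) inferInstance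
  mono' _ _ h := biSup_mono fun _ hp => le_trans hp h
  le' _ := iSup₂_le fun p _ => (hm p).comap_le

/-- Time runs over all integers: the increment is a centred variable independent of the past when `y
+ 1` is prime, and zero otherwise. -/
theorem martingale_sum_primesUpTo [IsProbabilityMeasure P] {Y : Nat.Primes → Ω → ℝ}
    (hm : ∀ p, Measurable (Y p)) (hi : ∀ p, Integrable (Y p) P) (h0 : ∀ p, ∫ ω, Y p ω ∂P = 0)
    (hind : iIndepFun Y P) :
    Martingale (fun y ω => ∑ p ∈ primesUpTo y, Y p ω) (primeFiltration Y hm) P := by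
  have hadp : StronglyAdapted (primeFiltration Y hm) fun y ω => ∑ p ∈ primesUpTo y, Y p ω := by
    intro y
    refine Finset.stronglyMeasurable_fun_sum _ fun p hp => ?_
    refine Measurable.stronglyMeasurable ?_
    refine Measurable.mono (comap_measurable (Y p)) ?_ le_rfl
    exact le_iSup₂_of_le p (mem_primesUpTo.1 hp) le_rfl
  refine martingale_of_condExp_sub_eq_zero_nat hadp
    (fun y => integrable_finsetSum _ fun p _ => hi p) fun y => ?_
  by_cases h : (y + 1).Prime
  · obtain ⟨q, hq⟩ : ∃ q : Nat.Primes, (q : ℕ) = y + 1 := ⟨⟨y + 1, h⟩, rfl⟩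
    have e : (fun ω => ∑ p ∈ primesUpTo (y + 1), Y p ω) - (fun ω => ∑ p ∈ primesUpTo y, Y p ω) =
        Y q := by
      ext ω
      rw [Pi.sub_apply, primesUpTo_succ_of_prime hq, Finset.sum_cons, add_sub_cancel_right]
    rw [e]
    have hindep : Indep (MeasurableSpace.comap (Y q) inferInstance)
        (primeFiltration Y hm y) P := by
      have := indep_iSup_of_disjoint (fun p => (hm p).comap_le) hind
        (S := {q}) (T := {p : Nat.Primes | (p : ℕ) ≤ y})
        (by rw [Set.disjoint_singleton_left, Set.mem_ofPred_eq, hq]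
            exact Nat.not_succ_le_self y)
      rwa [iSup_singleton] at this
    refine (condExp_indep_eq (hm _).comap_le ((primeFiltration Y hm).le _)
      (comap_measurable _).stronglyMeasurable hindep).trans ?_
    rw [h0]
    rfl
  · have e : (fun ω => ∑ p ∈ primesUpTo (y + 1), Y p ω) - (fun ω => ∑ p ∈ primesUpTo y, Y p ω) =
        0 := by
      rw [primesUpTo_succ_of_not_prime h, sub_self]
    rw [e, condExp_zero]

theorem summable_one_div_primes_sq : Summable fun p : Nat.Primes => 1 / ((p : ℕ) : ℝ) ^ 2 := by
  refine (summable_two_mul_one_div_primes_sq.mul_left (1 / 2)).congr fun p => ?_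
  rw [one_div_pow]; ring

/-- Doob's convergence theorem. The L¹ bound comes from `|x| ≤ exp x + exp(-x)` and the exponential
moments, which are uniform in `y` because `∑ 1/p²` converges. -/
theorem IsSteinhaus.ae_exists_tendsto_re (h : IsSteinhaus P X) [IsProbabilityMeasure P]
    (hm : ∀ p, Measurable (X p)) (hn : ∀ p ω, ‖X p ω‖ = 1) (v : ℂ) :
    ∀ᵐ ω ∂P, ∃ l : ℝ,
      Tendsto (fun y => (v * ∑ p ∈ primesUpTo y, X p ω / (p : ℕ)).re) atTop (𝓝 l) := by
  set Y : Nat.Primes → Ω → ℝ := fun p ω => (v / (p : ℕ) * X p ω).re with hY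
  have hYm : ∀ p, Measurable (Y p) := fun p => Complex.measurable_re.comp ((hm p).const_mul _)
  have hYi : ∀ p, Integrable (Y p) P := fun p => by
    refine Integrable.of_bound (hYm p).aestronglyMeasurable (‖v / (p : ℕ)‖)
      (Eventually.of_forall fun ω => (Complex.abs_re_le_norm _).trans_eq ?_)
    rw [norm_mul, hn, mul_one]
  have hYind : iIndepFun Y P := h.indep.comp (fun p w => (v / (p : ℕ) * w).re) fun p =>
    Complex.measurable_re.comp (measurable_id.const_mul _)
  have hsum : ∀ y ω, ∑ p ∈ primesUpTo y, Y p ω =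
      (v * ∑ p ∈ primesUpTo y, X p ω / (p : ℕ)).re := fun y ω => by
    rw [Finset.mul_sum, Complex.re_sum]
    refine Finset.sum_congr rfl fun p _ => ?_
    simp only [hY]
    congr 1
    ring
  have hmart := martingale_sum_primesUpTo hYm hYi (fun p => h.integral_re_mul hm hn _ p) hYind
  set V := ∑' p : Nat.Primes, 1 / ((p : ℕ) : ℝ) ^ 2 with hV
  have hexp : ∀ u : ℂ, ∀ y, ∫⁻ ω, ENNReal.ofReal
      (Real.exp (u * ∑ p ∈ primesUpTo y, X p ω / (p : ℕ)).re) ∂P ≤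
      ENNReal.ofReal (Real.exp (‖u‖ ^ 2 / 2 * V)) := fun u y => by
    have := h.setLIntegral_exp_sum_le hm hn (D := Set.univ) MeasurableSet.univ u
      (Finset.disjoint_empty_left (primesUpTo y))
    simp only [Finset.notMem_empty, IsEmpty.forall_iff, implies_true, Set.ofPred_true,
      Measure.restrict_univ, measure_univ, one_mul] at this
    refine this.trans (ENNReal.ofReal_le_ofReal (Real.exp_le_exp.2 ?_))
    gcongr
    exact summable_one_div_primes_sq.sum_le_tsum _ fun p _ => by positivity
  have hbdd : ∀ y, eLpNorm (fun ω => ∑ p ∈ primesUpTo y, Y p ω) 1 P ≤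
      ((2 * Real.exp (‖v‖ ^ 2 / 2 * V)).toNNReal : NNReal) := fun y => by
    rw [eLpNorm_one_eq_lintegral_enorm]
    calc _ ≤ ∫⁻ ω, (ENNReal.ofReal (Real.exp (v * ∑ p ∈ primesUpTo y, X p ω / (p : ℕ)).re) +
            ENNReal.ofReal (Real.exp (-v * ∑ p ∈ primesUpTo y, X p ω / (p : ℕ)).re)) ∂P := by
          refine lintegral_mono fun ω => ?_
          rw [hsum, Real.enorm_eq_ofReal_abs, ← ENNReal.ofReal_add (Real.exp_pos _).le
            (Real.exp_pos _).le]
          refine ENNReal.ofReal_le_ofReal ?_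
          rw [neg_mul, Complex.neg_re]
          set x := (v * ∑ p ∈ primesUpTo y, X p ω / (p : ℕ)).re
          have h1 := Real.add_one_le_exp x
          have h2 := Real.add_one_le_exp (-x)
          have h3 := Real.exp_pos x
          have h4 := Real.exp_pos (-x)
          rw [abs_le]
          constructor <;> linarith
      _ ≤ ENNReal.ofReal (Real.exp (‖v‖ ^ 2 / 2 * V)) +
            ENNReal.ofReal (Real.exp (‖v‖ ^ 2 / 2 * V)) := by
          rw [lintegral_add_left]
          · refine add_le_add (hexp v y) ?_
            simpa using hexp (-v) y
          · refine ENNReal.measurable_ofReal.comp (Real.measurable_exp.comp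
              (Complex.measurable_re.comp (Measurable.const_mul ?_ _)))
            exact Finset.measurable_fun_sum _ fun p _ => (hm p).div_const _
      _ = _ := by
          rw [← ENNReal.ofReal_add (Real.exp_pos _).le (Real.exp_pos _).le, ← two_mul]
          rfl
  filter_upwards [hmart.submartingale.exists_ae_tendsto_of_bdd hbdd] with ω hω
  simpa only [hsum] using hω

theorem IsSteinhaus.ae_exists_tendsto (h : IsSteinhaus P X) [IsProbabilityMeasure P]
    (hm : ∀ p, Measurable (X p)) (hn : ∀ p ω, ‖X p ω‖ = 1) :
    ∀ᵐ ω ∂P, ∃ l : ℂ, Tendsto (fun y => ∑ p ∈ primesUpTo y, X p ω / (p : ℕ)) atTop (𝓝 l) := by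
  filter_upwards [h.ae_exists_tendsto_re hm hn 1, h.ae_exists_tendsto_re hm hn (-Complex.I)]
    with ω ⟨a, ha⟩ ⟨b, hb⟩
  refine ⟨a + b * Complex.I, ?_⟩
  have := ((Complex.continuous_ofReal.tendsto a).comp ha).add
    (((Complex.continuous_ofReal.tendsto b).comp hb).mul_const Complex.I)
  refine this.congr fun y => ?_
  simp only [Function.comp_apply, one_mul, neg_mul, Complex.neg_re, Complex.I_mul_re, neg_neg]
  exact Complex.re_add_im _

end Steinhaus

/-! ### The logarithm of the Euler product -/

section EulerLog

/-- The logarithm `-log (1 - x p / p)` of the Euler factor. -/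
noncomputable def eulerLog (x : Nat.Primes → ℂ) (p : Nat.Primes) : ℂ :=
  -Complex.log (1 - x p / ((p : ℕ) : ℂ))

/-- The logarithm of the truncated Euler product. -/
noncomputable def logPartial (x : Nat.Primes → ℂ) (y : ℕ) : ℂ :=
  ∑ p ∈ primesUpTo y, eulerLog x p

/-- The logarithm of `L(1, x)`. -/
noncomputable def logL (x : Nat.Primes → ℂ) : ℂ :=
  limUnder atTop (logPartial x)

variable {x : Nat.Primes → ℂ}

theorem norm_div_prime (hx : ∀ p, ‖x p‖ = 1) (p : Nat.Primes) :
    ‖x p / ((p : ℕ) : ℂ)‖ = 1 / ((p : ℕ) : ℝ) := by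
  rw [norm_div, hx, Complex.norm_natCast]

theorem one_sub_div_prime_re_pos (hx : ∀ p, ‖x p‖ = 1) (p : Nat.Primes) :
    0 < (1 - x p / ((p : ℕ) : ℂ)).re := by
  have h1 := Complex.re_le_norm (x p / ((p : ℕ) : ℂ))
  rw [norm_div_prime hx] at h1
  have h2 := one_div_prime_le_half p
  rw [Complex.sub_re, Complex.one_re]
  linarith

theorem one_sub_div_prime_ne_zero (hx : ∀ p, ‖x p‖ = 1) (p : Nat.Primes) :
    1 - x p / ((p : ℕ) : ℂ) ≠ 0 := fun h => by
  have := one_sub_div_prime_re_pos hx p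
  rw [h] at this
  exact lt_irrefl _ this

theorem exp_eulerLog (hx : ∀ p, ‖x p‖ = 1) (p : Nat.Primes) :
    Complex.exp (eulerLog x p) = eulerFactor x p := by
  rw [eulerLog, Complex.exp_neg, Complex.exp_log (one_sub_div_prime_ne_zero hx p), eulerFactor]

theorem eulerLog_im (hx : ∀ p, ‖x p‖ = 1) (p : Nat.Primes) :
    (eulerLog x p).im = (eulerFactor x p).arg := by
  rw [eulerFactor, Complex.arg_inv, if_neg, eulerLog, Complex.neg_im, Complex.log_im]
  rw [Complex.arg_eq_pi_iff]
  exact fun h => (one_sub_div_prime_re_pos hx p).not_gt h.1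

theorem eulerLog_re (p : Nat.Primes) :
    (eulerLog x p).re = -Real.log ‖1 - x p / ((p : ℕ) : ℂ)‖ := by
  rw [eulerLog, Complex.neg_re, Complex.log_re]

theorem exp_logPartial (hx : ∀ p, ‖x p‖ = 1) (y : ℕ) :
    Complex.exp (logPartial x y) = eulerPartial x y := by
  rw [logPartial, Complex.exp_sum, eulerPartial]
  exact Finset.prod_congr rfl fun p _ => exp_eulerLog hx p

theorem logPartial_im (hx : ∀ p, ‖x p‖ = 1) (y : ℕ) : (logPartial x y).im = argPartial x y := by
  rw [logPartial, Complex.im_sum, argPartial]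
  exact Finset.sum_congr rfl fun p _ => eulerLog_im hx p

theorem norm_eulerLog_sub_le (hx : ∀ p, ‖x p‖ = 1) (p : Nat.Primes) :
    ‖eulerLog x p - x p / ((p : ℕ) : ℂ)‖ ≤ 1 / ((p : ℕ) : ℝ) ^ 2 := by
  set z := x p / ((p : ℕ) : ℂ) with hz
  have h2 : ‖z‖ ≤ 1 / 2 := (norm_div_prime hx p).trans_le (one_div_prime_le_half p)
  have h := Complex.norm_log_one_add_sub_self_le (z := -z) (by rw [norm_neg]; linarith)
  rw [norm_neg, sub_neg_eq_add, ← sub_eq_add_neg] at h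
  have e : eulerLog x p - z = -(Complex.log (1 - z) + z) := by rw [eulerLog]; ring
  rw [e, norm_neg, ← one_div_pow, ← norm_div_prime hx p, ← hz]
  refine h.trans ?_
  have h3 : (1 - ‖z‖)⁻¹ ≤ 2 := by
    rw [inv_le_comm₀ (by linarith) two_pos]; linarith
  nlinarith [sq_nonneg ‖z‖]

/-- The Taylor coefficients of `-log(1 - z)` are nonnegative, so its modulus on `‖z‖ = 1/p` is at
most its value at `z = 1/p`. -/
theorem norm_eulerLog_le (hx : ∀ p, ‖x p‖ = 1) (p : Nat.Primes) :
    ‖eulerLog x p‖ ≤ -Real.log (1 - 1 / ((p : ℕ) : ℝ)) := by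
  have hz : ‖x p / ((p : ℕ) : ℂ)‖ < 1 := by
    have := one_div_prime_le_half p
    rw [norm_div_prime hx]
    linarith
  have h1 := Complex.hasSum_taylorSeries_neg_log hz
  have h2 := Real.hasSum_pow_div_log_of_abs_lt_one (x := 1 / ((p : ℕ) : ℝ))
    (by rw [abs_of_pos (by have := p.cast_pos; positivity), ← norm_div_prime hx]; exact hz)
  have h3 : HasSum (fun n : ℕ => (1 / ((p : ℕ) : ℝ)) ^ n / n)
      (-Real.log (1 - 1 / ((p : ℕ) : ℝ))) := by
    rw [← hasSum_nat_add_iff' 1]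
    simpa using h2
  rw [eulerLog, ← h1.tsum_eq]
  refine tsum_of_norm_bounded h3 fun n => le_of_eq ?_
  rw [norm_div, norm_pow, norm_div_prime hx, Complex.norm_natCast]

/-- The terms differ from `x p / p` by `O(1/p²)`, so only the linear part can fail to converge
absolutely. -/
theorem exists_tendsto_logPartial (hx : ∀ p, ‖x p‖ = 1) {l : ℂ}
    (h : Tendsto (fun y => ∑ p ∈ primesUpTo y, x p / ((p : ℕ) : ℂ)) atTop (𝓝 l)) :
    Tendsto (logPartial x) atTop (𝓝 (logL x)) := by
  have hs : Summable fun p : Nat.Primes => eulerLog x p - x p / ((p : ℕ) : ℂ) :=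
    Summable.of_norm_bounded summable_one_div_primes_sq (norm_eulerLog_sub_le hx)
  have := h.add (hs.hasSum.comp tendsto_primesUpTo)
  have h2 : Tendsto (logPartial x) atTop
      (𝓝 (l + ∑' p : Nat.Primes, (eulerLog x p - x p / ((p : ℕ) : ℂ)))) := by
    refine this.congr fun y => ?_
    simp only [Function.comp_apply]
    rw [← Finset.sum_add_distrib, logPartial]
    exact Finset.sum_congr rfl fun p _ => by ring
  exact tendsto_nhds_limUnder ⟨_, h2⟩

theorem tendsto_eulerPartial_of_logPartial (hx : ∀ p, ‖x p‖ = 1)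
    (h : Tendsto (logPartial x) atTop (𝓝 (logL x))) :
    Tendsto (eulerPartial x) atTop (𝓝 (Complex.exp (logL x))) :=
  ((Complex.continuous_exp.tendsto _).comp h).congr fun y => exp_logPartial hx y

theorem tendsto_argPartial_of_logPartial (hx : ∀ p, ‖x p‖ = 1)
    (h : Tendsto (logPartial x) atTop (𝓝 (logL x))) :
    Tendsto (argPartial x) atTop (𝓝 (logL x).im) :=
  ((Complex.continuous_im.tendsto _).comp h).congr fun y => logPartial_im hx y

end EulerLog

/-! ### The contribution of the primes above `y` -/

section Tail

variable {Ω : Type*} [MeasurableSpace Ω] {P : Measure Ω} {X : Nat.Primes → Ω → ℂ}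

theorem IsSteinhaus.ae_tendsto_logPartial (h : IsSteinhaus P X) [IsProbabilityMeasure P]
    (hm : ∀ p, Measurable (X p)) (hn : ∀ p ω, ‖X p ω‖ = 1) :
    ∀ᵐ ω ∂P, Tendsto (logPartial fun p => X p ω) atTop (𝓝 (logL fun p => X p ω)) := by
  filter_upwards [h.ae_exists_tendsto hm hn] with ω ⟨l, hl⟩
  exact exists_tendsto_logPartial (fun p => hn p ω) hl

theorem measurable_logPartial (hm : ∀ p, Measurable (X p)) (y : ℕ) :
    Measurable fun ω => logPartial (fun p => X p ω) y := by
  refine Finset.measurable_fun_sum _ fun p _ => ?_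
  exact (Complex.measurable_log.comp (((hm p).div_const _).const_sub 1)).neg

theorem IsSteinhaus.aemeasurable_logL (h : IsSteinhaus P X) [IsProbabilityMeasure P]
    (hm : ∀ p, Measurable (X p)) (hn : ∀ p ω, ‖X p ω‖ = 1) :
    AEMeasurable (fun ω => logL fun p => X p ω) P :=
  aemeasurable_of_tendsto_metrizable_ae' (fun y => (measurable_logPartial hm y).aemeasurable)
    (h.ae_tendsto_logPartial hm hn)

/-- The exponential moment of the tail of `log L(1, X)`, on an event that depends only on the
`X p` with `p ≤ y`. -/
theorem IsSteinhaus.setLIntegral_exp_tail_le (h : IsSteinhaus P X) [IsProbabilityMeasure P]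
    (hm : ∀ p, Measurable (X p)) (hn : ∀ p ω, ‖X p ω‖ = 1) {D : Set ℂ} (hD : MeasurableSet D)
    (u : ℂ) {y : ℕ} (hy : 2 ≤ y) :
    ∫⁻ ω in {ω | ∀ p ∈ primesUpTo y, X p ω ∈ D},
        ENNReal.ofReal (Real.exp
          (u * (logL (fun p => X p ω) - logPartial (fun p => X p ω) y)).re) ∂P ≤
      P {ω | ∀ p ∈ primesUpTo y, X p ω ∈ D} *
        ENNReal.ofReal (Real.exp ((‖u‖ + ‖u‖ ^ 2 / 2) * (2 * Real.log 4 / (y * Real.log y)))) := by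
  set B : Set Ω := {ω | ∀ p ∈ primesUpTo y, X p ω ∈ D} with hB
  set V := 2 * Real.log 4 / (y * Real.log y) with hV
  set F : ℕ → Ω → ENNReal := fun z ω => ENNReal.ofReal (Real.exp
    (u * (logPartial (fun p => X p ω) z - logPartial (fun p => X p ω) y)).re) with hF
  have hFm : ∀ z, Measurable (F z) := fun z =>
    ENNReal.measurable_ofReal.comp (Real.measurable_exp.comp (Complex.measurable_re.comp
      (((measurable_logPartial hm z).sub (measurable_logPartial hm y)).const_mul u)))
  have hbound : ∀ z, y ≤ z → ∫⁻ ω in B, F z ω ∂P ≤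
      P B * ENNReal.ofReal (Real.exp ((‖u‖ + ‖u‖ ^ 2 / 2) * V)) := by
    intro z hz
    set s := primesUpTo z \ primesUpTo y with hs
    have hsV : ∑ p ∈ s, 1 / ((p : ℕ) : ℝ) ^ 2 ≤ V := sum_one_div_sq_sdiff_le hy hz
    have hsub : primesUpTo y ⊆ primesUpTo z := fun p hp =>
      mem_primesUpTo.2 ((mem_primesUpTo.1 hp).trans hz)
    -- The factor `exp(‖u‖ V)` pays for replacing each logarithm by its linear term.
    have hpt : ∀ ω, F z ω ≤ ENNReal.ofReal (Real.exp (‖u‖ * V)) *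
        ENNReal.ofReal (Real.exp (u * ∑ p ∈ s, X p ω / (p : ℕ)).re) := fun ω => by
      rw [← ENNReal.ofReal_mul (Real.exp_pos _).le, ← Real.exp_add]
      refine ENNReal.ofReal_le_ofReal (Real.exp_le_exp.2 ?_)
      have e : logPartial (fun p => X p ω) z - logPartial (fun p => X p ω) y =
          ∑ p ∈ s, eulerLog (fun p => X p ω) p := by
        rw [logPartial, logPartial, sub_eq_iff_eq_add, Finset.sum_sdiff hsub]
      have e2 : u * ∑ p ∈ s, eulerLog (fun p => X p ω) p =
          u * (∑ p ∈ s, (eulerLog (fun p => X p ω) p - X p ω / (p : ℕ))) +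
            u * ∑ p ∈ s, X p ω / (p : ℕ) := by
        rw [← mul_add, ← Finset.sum_add_distrib]
        congr 1
        exact Finset.sum_congr rfl fun p _ => by ring
      rw [e, e2, Complex.add_re]
      refine add_le_add ((Complex.re_le_norm _).trans ?_) le_rfl
      rw [norm_mul]
      gcongr
      refine (norm_sum_le _ _).trans (le_trans (Finset.sum_le_sum fun p _ => ?_) hsV)
      exact norm_eulerLog_sub_le (fun p => hn p ω) p
    calc ∫⁻ ω in B, F z ω ∂P
        ≤ ∫⁻ ω in B, ENNReal.ofReal (Real.exp (‖u‖ * V)) *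
            ENNReal.ofReal (Real.exp (u * ∑ p ∈ s, X p ω / (p : ℕ)).re) ∂P :=
          lintegral_mono fun ω => hpt ω
      _ = ENNReal.ofReal (Real.exp (‖u‖ * V)) * ∫⁻ ω in B,
            ENNReal.ofReal (Real.exp (u * ∑ p ∈ s, X p ω / (p : ℕ)).re) ∂P :=
          lintegral_const_mul' _ _ ENNReal.ofReal_ne_top
      _ ≤ ENNReal.ofReal (Real.exp (‖u‖ * V)) *
            (P B * ENNReal.ofReal (Real.exp (‖u‖ ^ 2 / 2 * V))) := by
          gcongr
          refine (h.setLIntegral_exp_sum_le hm hn hD u Finset.disjoint_sdiff).trans ?_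
          gcongr
      _ = _ := by
          rw [mul_left_comm, ← ENNReal.ofReal_mul (Real.exp_pos _).le, ← Real.exp_add, add_mul]
  have hlim : ∀ᵐ ω ∂(P.restrict B), Tendsto (fun z => F z ω) atTop (𝓝 (ENNReal.ofReal (Real.exp
      (u * (logL (fun p => X p ω) - logPartial (fun p => X p ω) y)).re))) := by
    filter_upwards [ae_restrict_of_ae (h.ae_tendsto_logPartial hm hn)] with ω hω
    refine (ENNReal.continuous_ofReal.tendsto _).comp ((Real.continuous_exp.tendsto _).comp
      ((Complex.continuous_re.tendsto _).comp ((hω.sub_const _).const_mul u)))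
  -- Fatou's lemma carries the bound, uniform in the upper cutoff `z`, over to the infinite tail.
  calc _ = ∫⁻ ω in B, liminf (fun z => F z ω) atTop ∂P :=
        lintegral_congr_ae (hlim.mono fun ω hω => hω.liminf_eq.symm)
    _ ≤ liminf (fun z => ∫⁻ ω in B, F z ω ∂P) atTop := lintegral_liminf_le hFm
    _ ≤ _ := by
        refine liminf_le_of_frequently_le' (Eventually.frequently ?_)
        exact (eventually_ge_atTop y).mono hbound

/-- A Chernoff bound for `log L(1, X)`. -/
theorem IsSteinhaus.measure_le_re_mul_logL_le (h : IsSteinhaus P X) [IsProbabilityMeasure P]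
    (hm : ∀ p, Measurable (X p)) (hn : ∀ p ω, ‖X p ω‖ = 1) (u : ℂ) (a : ℝ) {y : ℕ} (hy : 2 ≤ y) :
    P {ω | a ≤ (u * logL fun p => X p ω).re} ≤ ENNReal.ofReal (Real.exp
      (‖u‖ * (∑ p ∈ primesUpTo y, -Real.log (1 - 1 / ((p : ℕ) : ℝ))) +
        (‖u‖ + ‖u‖ ^ 2 / 2) * (2 * Real.log 4 / (y * Real.log y)) - a)) := by
  set M := ‖u‖ * ∑ p ∈ primesUpTo y, -Real.log (1 - 1 / ((p : ℕ) : ℝ)) with hM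
  set T : Ω → ℂ := fun ω => logL (fun p => X p ω) - logPartial (fun p => X p ω) y with hT
  have hTm : AEMeasurable T P :=
    (h.aemeasurable_logL hm hn).sub (measurable_logPartial hm y).aemeasurable
  have htail := h.setLIntegral_exp_tail_le hm hn MeasurableSet.univ u hy
  simp only [Set.mem_univ, implies_true, Set.ofPred_true, Measure.restrict_univ, measure_univ,
    one_mul] at htail
  -- The primes up to `y` contribute at most `M` for every `ω`, so the event forces the tail to be
  -- at least `a - M`; Markov's inequality is applied to the tail alone.
  have hsub : {ω | a ≤ (u * logL fun p => X p ω).re} ⊆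
      {ω | ENNReal.ofReal (Real.exp (a - M)) ≤ ENNReal.ofReal (Real.exp (u * T ω).re)} := by
    intro ω hω
    refine ENNReal.ofReal_le_ofReal (Real.exp_le_exp.2 ?_)
    have hω : a ≤ (u * logL fun p => X p ω).re := hω
    have e : u * logL (fun p => X p ω) = u * logPartial (fun p => X p ω) y + u * T ω := by
      simp only [hT]; ring
    rw [e, Complex.add_re] at hω
    have : (u * logPartial (fun p => X p ω) y).re ≤ M := by
      refine (Complex.re_le_norm _).trans ?_
      rw [norm_mul, hM]
      gcongr
      exact (norm_sum_le _ _).trans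
        (Finset.sum_le_sum fun p _ => norm_eulerLog_le (fun p => hn p ω) p)
    linarith
  refine (measure_mono hsub).trans ?_
  have hmk := meas_ge_le_lintegral_div (μ := P)
    (f := fun ω => ENNReal.ofReal (Real.exp (u * T ω).re))
    (ENNReal.measurable_ofReal.comp_aemeasurable (Real.measurable_exp.comp_aemeasurable
      (Complex.measurable_re.comp_aemeasurable (hTm.const_mul u))))
    (ε := ENNReal.ofReal (Real.exp (a - M)))
    (by rw [Ne, ENNReal.ofReal_eq_zero, not_le]; exact Real.exp_pos _) ENNReal.ofReal_ne_top
  refine hmk.trans ((ENNReal.div_le_div_right htail _).trans_eq ?_)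
  rw [← ENNReal.ofReal_div_of_pos (Real.exp_pos _), ← Real.exp_sub]
  congr 2
  ring

/-- If the exponential moment bound is strong enough, then the tail of `log L(1, X)` is harmless
with probability at least `1 / 2` conditionally on the `X p` with `p ≤ y`. -/
theorem IsSteinhaus.half_le_measure_inter (h : IsSteinhaus P X) [IsProbabilityMeasure P]
    (hm : ∀ p, Measurable (X p)) (hn : ∀ p ω, ‖X p ω‖ = 1) {D : Set ℂ} (hD : MeasurableSet D)
    {y : ℕ} (hy : 2 ≤ y) {r δ : ℝ} (hr : 0 < r)
    (hδ : Real.exp ((r + r ^ 2 / 2) * (2 * Real.log 4 / (y * Real.log y)) - r * δ) ≤ 1 / 4) :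
    (∏ _p ∈ primesUpTo y, circleUniform.real D) / 2 ≤
      P.real {ω | (∀ p ∈ primesUpTo y, X p ω ∈ D) ∧
        -δ < (logL (fun p => X p ω) - logPartial (fun p => X p ω) y).re ∧
        -δ < (logL (fun p => X p ω) - logPartial (fun p => X p ω) y).im} := by
  set B : Set Ω := {ω | ∀ p ∈ primesUpTo y, X p ω ∈ D} with hB
  set T : Ω → ℂ := fun ω => logL (fun p => X p ω) - logPartial (fun p => X p ω) y with hT
  have hTm : AEMeasurable T P :=
    (h.aemeasurable_logL hm hn).sub (measurable_logPartial hm y).aemeasurable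
  have hBe : B = ⋂ p ∈ primesUpTo y, X p ⁻¹' D := by ext ω; simp [hB]
  have hBm : MeasurableSet B := by
    rw [hBe]
    exact Finset.measurableSet_biInter _ fun p _ => hm p hD
  have hPB : P.real B = ∏ _p ∈ primesUpTo y, circleUniform.real D := by
    rw [measureReal_def, hBe, h.indep.measure_inter_preimage_eq_mul (primesUpTo y)
      (sets := fun _ => D) (fun _ _ => hD), ENNReal.toReal_prod]
    refine Finset.prod_congr rfl fun p _ => ?_
    rw [measureReal_def, ← (h.law p).map_eq, Measure.map_apply (hm p) hD]
  -- Used with `u = -r` and `u = r i`, which detect a tail with real part, respectively imaginary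
  -- part, at most `-δ`. Each loses at most a quarter of the mass of `B`.
  have bad : ∀ u : ℂ, ‖u‖ = r → P.real (B ∩ {ω | r * δ ≤ (u * T ω).re}) ≤ P.real B / 4 := by
    intro u hu
    have htail := h.setLIntegral_exp_tail_le hm hn hD u hy
    have hmk := meas_ge_le_lintegral_div (μ := P.restrict B)
      (f := fun ω => ENNReal.ofReal (Real.exp (u * T ω).re))
      (ENNReal.measurable_ofReal.comp_aemeasurable (Real.measurable_exp.comp_aemeasurable
        (Complex.measurable_re.comp_aemeasurable (hTm.restrict.const_mul u))))
      (ε := ENNReal.ofReal (Real.exp (r * δ)))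
      (by rw [Ne, ENNReal.ofReal_eq_zero, not_le]; exact Real.exp_pos _) ENNReal.ofReal_ne_top
    have hsub : {ω | r * δ ≤ (u * T ω).re} ⊆
        {ω | ENNReal.ofReal (Real.exp (r * δ)) ≤ ENNReal.ofReal (Real.exp (u * T ω).re)} :=
      fun ω hω => ENNReal.ofReal_le_ofReal (Real.exp_le_exp.2 hω)
    have h1 : P (B ∩ {ω | r * δ ≤ (u * T ω).re}) ≤ P B * ENNReal.ofReal (1 / 4) := by
      rw [Set.inter_comm]
      calc _ ≤ (P.restrict B) {ω | r * δ ≤ (u * T ω).re} := Measure.le_restrict_apply _ _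
        _ ≤ _ := measure_mono hsub
        _ ≤ _ := hmk
        _ ≤ (P B * ENNReal.ofReal (Real.exp ((‖u‖ + ‖u‖ ^ 2 / 2) *
              (2 * Real.log 4 / (y * Real.log y))))) / ENNReal.ofReal (Real.exp (r * δ)) :=
            ENNReal.div_le_div_right htail _
        _ ≤ _ := by
            rw [mul_div_assoc, ← ENNReal.ofReal_div_of_pos (Real.exp_pos _), ← Real.exp_sub, hu]
            gcongr
    have h2 := ENNReal.toReal_mono (by finiteness) h1
    rw [ENNReal.toReal_mul, ENNReal.toReal_ofReal (by norm_num)] at h2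
    simp only [measureReal_def]
    linarith
  have hcover : B ⊆ {ω | (∀ p ∈ primesUpTo y, X p ω ∈ D) ∧ -δ < (T ω).re ∧ -δ < (T ω).im} ∪
      ((B ∩ {ω | r * δ ≤ ((-r : ℝ) * T ω).re}) ∪
        (B ∩ {ω | r * δ ≤ ((r : ℝ) * Complex.I * T ω).re})) := by
    intro ω hω
    by_cases h1 : -δ < (T ω).re
    · by_cases h2 : -δ < (T ω).im
      · exact Or.inl ⟨hω, h1, h2⟩
      · refine Or.inr (Or.inr ⟨hω, ?_⟩)
        rw [not_lt] at h2
        simp only [Set.mem_ofPred_eq, mul_assoc, Complex.re_ofReal_mul, Complex.I_mul_re]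
        exact mul_le_mul_of_nonneg_left (by linarith) hr.le
    · refine Or.inr (Or.inl ⟨hω, ?_⟩)
      rw [not_lt] at h1
      simp only [Set.mem_ofPred_eq, Complex.re_ofReal_mul]
      rw [neg_mul, ← mul_neg]
      exact mul_le_mul_of_nonneg_left (by linarith) hr.le
  have h3 := (measureReal_mono (μ := P) hcover).trans ((measureReal_union_le _ _).trans
    (add_le_add le_rfl (measureReal_union_le _ _)))
  have b1 := bad ((-r : ℝ) : ℂ) (by rw [Complex.norm_real, norm_neg, Real.norm_of_nonneg hr.le])
  have b2 := bad ((r : ℝ) * Complex.I)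
    (by rw [norm_mul, Complex.norm_real, Complex.norm_I, mul_one, Real.norm_of_nonneg hr.le])
  rw [← hPB]
  linarith

end Tail

/-! ### The upper bound for the joint tail -/

section UpperBound

variable {Ω : Type*} [MeasurableSpace Ω] {P : Measure Ω} {X : Nat.Primes → Ω → ℂ}

theorem IsSteinhaus.ae_eulerL_eq (h : IsSteinhaus P X) [IsProbabilityMeasure P]
    (hm : ∀ p, Measurable (X p)) (hn : ∀ p ω, ‖X p ω‖ = 1) :
    ∀ᵐ ω ∂P, eulerL (fun p => X p ω) = Complex.exp (logL fun p => X p ω) ∧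
      argL (fun p => X p ω) = (logL fun p => X p ω).im := by
  filter_upwards [h.ae_tendsto_logPartial hm hn] with ω hω
  exact ⟨(tendsto_eulerPartial_of_logPartial (fun p => hn p ω) hω).limUnder_eq,
    (tendsto_argPartial_of_logPartial (fun p => hn p ω) hω).limUnder_eq⟩

theorem IsSteinhaus.jointTail_eq (h : IsSteinhaus P X) [IsProbabilityMeasure P]
    (hm : ∀ p, Measurable (X p)) (hn : ∀ p ω, ‖X p ω‖ = 1) {τ : ℝ} (hτ : 0 < τ) (θ : ℝ) :
    jointTail P X τ θ = P.real {ω |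
      Real.eulerMascheroniConstant + Real.log τ < (logL fun p => X p ω).re ∧
        θ < |(logL fun p => X p ω).im|} := by
  refine measureReal_congr ?_
  filter_upwards [h.ae_eulerL_eq hm hn] with ω ⟨h1, h2⟩
  refine propext (and_congr ?_ ?_)
  · rw [h1, Complex.norm_exp, ← Real.exp_lt_exp (x := _ + _), Real.exp_add, Real.exp_log hτ]
  · rw [h2]

theorem half_le_floor {Y : ℝ} (hY : 1 ≤ Y) : Y / 2 ≤ ⌊Y⌋₊ := by
  have h1 := Nat.lt_floor_add_one Y
  have h2 : (1 : ℝ) ≤ ⌊Y⌋₊ := by exact_mod_cast Nat.le_floor (by exact_mod_cast hY)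
  linarith

theorem sub_one_le_log_floor_exp {w : ℝ} (hw : 0 ≤ w) : w - 1 ≤ Real.log ⌊Real.exp w⌋₊ := by
  have h1 := half_le_floor (Real.one_le_exp hw)
  have h2 := Real.log_le_log (by positivity) h1
  rw [Real.log_div (Real.exp_ne_zero _) two_ne_zero, Real.log_exp] at h2
  have := Real.log_two_lt_d9
  linarith

theorem log_floor_exp_le {w : ℝ} (hw : 0 ≤ w) : Real.log ⌊Real.exp w⌋₊ ≤ w := by
  have h1 := half_le_floor (Real.one_le_exp hw)
  have h0 : (0 : ℝ) < ⌊Real.exp w⌋₊ := lt_of_lt_of_le (by positivity) h1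
  rw [Real.log_le_iff_le_exp h0]
  exact Nat.floor_le (Real.exp_pos _).le

theorem log_four_lt_two : Real.log 4 < 2 := by
  have : Real.log 4 = 2 * Real.log 2 := by
    rw [show (4 : ℝ) = 2 ^ 2 by norm_num, Real.log_pow]; norm_num
  have := Real.log_two_lt_d9
  linarith

/-- The two Chernoff bounds, in the directions `exp (∓ i β)`. -/
theorem IsSteinhaus.jointTail_le_two_mul_exp (h : IsSteinhaus P X) [IsProbabilityMeasure P]
    (hm : ∀ p, Measurable (X p)) (hn : ∀ p ω, ‖X p ω‖ = 1) {τ θ β : ℝ} (hτ : 0 < τ)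
    (hβ0 : 0 ≤ β) (hβ1 : β ≤ 1) {y : ℕ} (hy : 2 ≤ y) :
    jointTail P X τ θ ≤ 2 * Real.exp (y *
      ((∑ p ∈ primesUpTo y, -Real.log (1 - 1 / ((p : ℕ) : ℝ))) + 4 / Real.log y -
        (Real.cos β * (Real.eulerMascheroniConstant + Real.log τ) + Real.sin β * θ))) := by
  set γ := Real.eulerMascheroniConstant
  set S := ∑ p ∈ primesUpTo y, -Real.log (1 - 1 / ((p : ℕ) : ℝ)) with hS
  set a : ℝ := y * (Real.cos β * (γ + Real.log τ) + Real.sin β * θ) with ha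
  have hy2 : (2 : ℝ) ≤ y := by exact_mod_cast hy
  have hlog : 0 < Real.log y := Real.log_pos (by linarith)
  have hcos : 0 ≤ Real.cos β := Real.cos_nonneg_of_neg_pi_div_two_le_of_le
    (by linarith [Real.pi_gt_three]) (by linarith [Real.pi_gt_three])
  have hsin : 0 ≤ Real.sin β :=
    Real.sin_nonneg_of_nonneg_of_le_pi hβ0 (by linarith [Real.pi_gt_three])
  have hone : ∀ η : ℝ, P.real {ω | a ≤ ((y : ℝ) * Complex.exp (η * Complex.I) *
      logL fun p => X p ω).re} ≤ Real.exp (y * (S + 4 / Real.log y) - a) := by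
    intro η
    have h1 := h.measure_le_re_mul_logL_le hm hn ((y : ℝ) * Complex.exp (η * Complex.I)) a hy
    have hnorm : ‖((y : ℝ) : ℂ) * Complex.exp (η * Complex.I)‖ = y := by
      rw [norm_mul, Complex.norm_exp_ofReal_mul_I, mul_one, Complex.norm_real,
        Real.norm_of_nonneg (by linarith)]
    rw [hnorm] at h1
    have h2 := ENNReal.toReal_mono ENNReal.ofReal_ne_top h1
    rw [ENNReal.toReal_ofReal (Real.exp_pos _).le] at h2
    refine h2.trans (Real.exp_le_exp.2 ?_)
    -- With `‖u‖ = y` the tail moment costs only `O(y / log y)`, whereas a shortfall `η` in the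
    -- threshold gains `η y`.
    have h3 : ((y : ℝ) + (y : ℝ) ^ 2 / 2) * (2 * Real.log 4 / (y * Real.log y)) ≤
        y * (4 / Real.log y) := by
      have e1 : ((y : ℝ) + (y : ℝ) ^ 2 / 2) * (2 * Real.log 4 / (y * Real.log y)) =
          (1 + y / 2) * (2 * Real.log 4) / Real.log y := by field_simp
      rw [e1, ← mul_div_assoc]
      refine div_le_div_of_nonneg_right ?_ hlog.le
      have := log_four_lt_two
      have : 0 < Real.log 4 := Real.log_pos (by norm_num)
      nlinarith
    rw [← hS]
    linarith
  -- The sign of the argument decides which of the two directions sees it positively.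
  have hcover : {ω | γ + Real.log τ < (logL fun p => X p ω).re ∧ θ < |(logL fun p => X p ω).im|} ⊆
      {ω | a ≤ ((y : ℝ) * Complex.exp ((-β : ℝ) * Complex.I) * logL fun p => X p ω).re} ∪
      {ω | a ≤ ((y : ℝ) * Complex.exp ((β : ℝ) * Complex.I) * logL fun p => X p ω).re} := by
    rintro ω ⟨h1, h2⟩
    have hre : ∀ η : ℝ, ((y : ℝ) * Complex.exp (η * Complex.I) * logL fun p => X p ω).re =
        y * (Real.cos η * (logL fun p => X p ω).re - Real.sin η * (logL fun p => X p ω).im) := by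
      intro η
      rw [mul_assoc, Complex.re_ofReal_mul, Complex.mul_re, Complex.exp_ofReal_mul_I_re,
        Complex.exp_ofReal_mul_I_im]
    have h3 := mul_le_mul_of_nonneg_left h1.le hcos
    rcases lt_abs.1 h2 with h4 | h4
    · refine Or.inl ?_
      rw [Set.mem_ofPred_eq, hre, Real.cos_neg, Real.sin_neg, ha]
      have h5 := mul_le_mul_of_nonneg_left h4.le hsin
      refine mul_le_mul_of_nonneg_left ?_ (by linarith)
      linarith
    · refine Or.inr ?_
      rw [Set.mem_ofPred_eq, hre, ha]
      have h5 := mul_le_mul_of_nonneg_left h4.le hsin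
      refine mul_le_mul_of_nonneg_left ?_ (by linarith)
      linarith
  rw [h.jointTail_eq hm hn hτ]
  refine (measureReal_mono hcover).trans ((measureReal_union_le _ _).trans
    ((add_le_add (hone _) (hone _)).trans_eq ?_))
  rw [← two_mul, ha]
  congr 2
  ring

/-- Source of the main term: the cosine loses `β² l / 2`, the sine gains `β² l`. The quartic term is
`O(β²)` because `β l` is bounded. -/
theorem cos_mul_add_sin_mul_ge {A β l : ℝ} (hβ0 : 0 ≤ β) (hβ1 : β ≤ 1) (hl : 0 ≤ l)
    (hA : β * l ≤ A) :
    Real.eulerMascheroniConstant + l + β ^ 2 * l / 2 - (1 + A) * β ^ 2 ≤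
      Real.cos β * (Real.eulerMascheroniConstant + l) + Real.sin β * (β * l) := by
  have hγ0 := Real.one_half_lt_eulerMascheroniConstant
  have hγ1 := Real.eulerMascheroniConstant_lt_two_thirds
  have h1 := Real.one_sub_sq_div_two_le_cos (x := β)
  have h2 : β - β ^ 3 / 6 ≤ Real.sin β := by
    rcases hβ0.eq_or_lt with rfl | h
    · simp
    · exact (Real.sin_gt_sub_cube h).le
  have h3 := mul_le_mul_of_nonneg_right h1
    (show 0 ≤ Real.eulerMascheroniConstant + l by linarith)
  have h4 := mul_le_mul_of_nonneg_right h2 (show 0 ≤ β * l by positivity)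
  have h5 : β ^ 3 * (β * l) ≤ A * β ^ 2 := by
    have hA0 : 0 ≤ A := le_trans (by positivity) hA
    calc β ^ 3 * (β * l) ≤ β ^ 2 * A := by
          refine mul_le_mul ?_ hA (by positivity) (by positivity)
          exact pow_le_pow_of_le_one hβ0 hβ1 (by norm_num)
      _ = _ := by ring
  have h6 : β ^ 2 * Real.eulerMascheroniConstant ≤ β ^ 2 * 1 := by gcongr; linarith
  have h7 : 0 ≤ A * β ^ 2 := le_trans (by positivity) h5
  have h8 := sq_nonneg β
  have e3 : (1 - β ^ 2 / 2) * (Real.eulerMascheroniConstant + l) + (β - β ^ 3 / 6) * (β * l) =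
      Real.eulerMascheroniConstant + l + β ^ 2 * l / 2 -
        β ^ 2 * Real.eulerMascheroniConstant / 2 - β ^ 3 * (β * l) / 6 := by ring
  linarith

theorem exists_jointTail_le {A : ℝ} (hA : 0 < A) :
    ∃ K τ₀ : ℝ, 0 < K ∧ ∀ τ β : ℝ, τ₀ ≤ τ → 0 < β → β * Real.log τ ≤ A → 1 ≤ β ^ 2 * τ →
      ∀ {Ω : Type*} [MeasurableSpace Ω] (P : Measure Ω) [IsProbabilityMeasure P]
        (X : Nat.Primes → Ω → ℂ), IsSteinhaus P X → (∀ p, Measurable (X p)) →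
        (∀ p ω, ‖X p ω‖ = 1) →
        jointTail P X τ (β * Real.log τ) ≤
          Real.exp (-(Real.exp (τ + β ^ 2 * Real.log τ * τ / 2 - K * (β ^ 2 * τ)) / τ)) := by
  obtain ⟨C, hC0, hC⟩ := exists_mertens
  -- The budget in units of `β² ≥ 1/τ`: `2C + 8` for `(C + 4) / log y` with `log y ≥ τ/2`, `1 + A`
  -- for the expansion of cosine and sine, and `4` for the margin `4/τ` left in the exponent.
  set K := 2 * C + A + 13 with hK
  refine ⟨K, max 2 (Real.exp (max A (2 * K))), by linarith, ?_⟩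
  intro τ β hτ hβ0 hβA hβτ Ω _ P _ X h hm hn
  set l := Real.log τ with hl
  have hτ2 : 2 ≤ τ := (le_max_left _ _).trans hτ
  have hτ0 : 0 < τ := by linarith
  have hlτ : max A (2 * K) ≤ l := by
    rw [hl, Real.le_log_iff_exp_le hτ0]; exact (le_max_right _ _).trans hτ
  have hlA : A ≤ l := (le_max_left _ _).trans hlτ
  have hlK : 2 * K ≤ l := (le_max_right _ _).trans hlτ
  have hl0 : 0 < l := hA.trans_le hlA
  have hβ1 : β ≤ 1 := by
    have : β * l ≤ 1 * l := by linarith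
    exact le_of_mul_le_mul_right this hl0
  have hβ2 : 0 < β ^ 2 := by positivity
  have hinv : 1 / τ ≤ β ^ 2 := by rwa [div_le_iff₀ hτ0]
  set v := β ^ 2 * l / 2 - K * β ^ 2 with hv
  have hv0 : 0 ≤ v := by rw [hv]; nlinarith
  set w := τ * Real.exp v with hw
  have hev : 1 + v ≤ Real.exp v := by linarith [Real.add_one_le_exp v]
  have hwτ : τ * (1 + v) ≤ w := mul_le_mul_of_nonneg_left hev hτ0.le
  have hτw : τ ≤ w := by nlinarith
  have hw0 : 0 < w := by linarith
  set y := ⌊Real.exp w⌋₊ with hy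
  have hylo : w - 1 ≤ Real.log y := sub_one_le_log_floor_exp hw0.le
  have hyhi : Real.log y ≤ w := log_floor_exp_le hw0.le
  have hyhalf : Real.exp w / 2 ≤ y := half_le_floor (Real.one_le_exp hw0.le)
  have hlogy : τ / 2 ≤ Real.log y := by linarith
  have hlogy0 : 0 < Real.log y := by linarith
  have hy2 : 2 ≤ y := by
    refine Nat.le_floor ?_
    have := Real.add_one_le_exp w
    push_cast
    linarith
  have hll : Real.log (Real.log y) ≤ l + v := by
    have := Real.log_le_log hlogy0 hyhi
    rwa [hw, Real.log_mul hτ0.ne' (Real.exp_ne_zero _), Real.log_exp] at this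
  have hmert := (abs_le.1 (hC y hy2).2).2
  have hClog : (C + 4) / Real.log y ≤ (2 * C + 8) * β ^ 2 := by
    calc (C + 4) / Real.log y ≤ (C + 4) / (τ / 2) := by gcongr
      _ = (2 * C + 8) * (1 / τ) := by field_simp; ring
      _ ≤ _ := by gcongr
  have hcs := cos_mul_add_sin_mul_ge hβ0.le hβ1 hl0.le hβA
  refine (h.jointTail_le_two_mul_exp hm hn hτ0 hβ0.le hβ1 hy2).trans ?_
  have hbr : (∑ p ∈ primesUpTo y, -Real.log (1 - 1 / ((p : ℕ) : ℝ))) + 4 / Real.log y -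
      (Real.cos β * (Real.eulerMascheroniConstant + l) + Real.sin β * (β * l)) ≤ -(4 / τ) := by
    have e : (C + 4) / Real.log y = C / Real.log y + 4 / Real.log y := add_div _ _ _
    have e2 : 4 / τ = 4 * (1 / τ) := by ring
    rw [e2]
    have : v = β ^ 2 * l / 2 - (2 * C + A + 13) * β ^ 2 := hv
    linarith
  have hY : Real.exp (τ + β ^ 2 * l * τ / 2 - K * (β ^ 2 * τ)) ≤ 2 * y := by
    have e : τ + β ^ 2 * l * τ / 2 - K * (β ^ 2 * τ) = τ * (1 + v) := by rw [hv]; ring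
    rw [e]
    have := Real.exp_le_exp.2 hwτ
    linarith
  have hyτ : τ ≤ 2 * y := by
    have := Real.add_one_le_exp w
    linarith
  -- The factor `2` from the two directions is at most `exp 1`, and half of the exponent `4y/τ`
  -- absorbs it because `2y/τ ≥ 1`.
  have h2 : (2 : ℝ) ≤ Real.exp 1 := by linarith [Real.add_one_le_exp 1]
  calc 2 * Real.exp (y * _) ≤ Real.exp 1 * Real.exp (y * -(4 / τ)) := by gcongr
    _ = Real.exp (1 - 2 * (2 * y) / τ) := by rw [← Real.exp_add]; congr 1; ring
    _ ≤ _ := by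
      refine Real.exp_le_exp.2 ?_
      have h3 : 1 ≤ 2 * y / τ := by rwa [le_div_iff₀ hτ0, one_mul]
      have h4 := div_le_div_of_nonneg_right hY hτ0.le
      have e : 2 * (2 * (y : ℝ)) / τ = 2 * (2 * y / τ) := by ring
      rw [e]
      linarith

end UpperBound

/-! ### Euler factors whose variables lie on a short arc -/

section LowerBound

variable {x : Nat.Primes → ℂ}

theorem div_prime_eq (hx : ∀ p, ‖x p‖ = 1) (p : Nat.Primes) :
    x p / ((p : ℕ) : ℂ) =
      ((1 / ((p : ℕ) : ℝ) : ℝ) : ℂ) * Complex.exp ((x p).arg * Complex.I) := by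
  have h := Complex.norm_mul_exp_arg_mul_I (x p)
  rw [hx, Complex.ofReal_one, one_mul] at h
  rw [h]
  push_cast
  ring

theorem one_sub_div_prime_im (hx : ∀ p, ‖x p‖ = 1) (p : Nat.Primes) :
    (1 - x p / ((p : ℕ) : ℂ)).im = -(1 / ((p : ℕ) : ℝ) * Real.sin (x p).arg) := by
  rw [div_prime_eq hx, Complex.sub_im, Complex.im_ofReal_mul, Complex.exp_ofReal_mul_I_im,
    Complex.one_im, zero_sub]

theorem norm_one_sub_div_prime_sq (hx : ∀ p, ‖x p‖ = 1) (p : Nat.Primes) :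
    ‖1 - x p / ((p : ℕ) : ℂ)‖ ^ 2 =
      1 - 2 * (1 / ((p : ℕ) : ℝ)) * Real.cos (x p).arg + (1 / ((p : ℕ) : ℝ)) ^ 2 := by
  rw [← Complex.normSq_eq_norm_sq, Complex.normSq_apply, one_sub_div_prime_im hx]
  rw [div_prime_eq hx, Complex.sub_re, Complex.re_ofReal_mul, Complex.exp_ofReal_mul_I_re,
    Complex.one_re]
  have := Real.sin_sq_add_cos_sq (x p).arg
  linear_combination (1 / ((p : ℕ) : ℝ)) ^ 2 * this

/-- With `q = 1/p`, the squared distance is `(1-q)² + 2q(1 - cos φ) ≤ (1-q)² + q φ²`. Taking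
logarithms gives the loss `q φ² / (2(1-q)²)`, and `q/(1-q)² ≤ q + 8q²` for `q ≤ 1/2`. -/
theorem eulerLog_re_ge (hx : ∀ p, ‖x p‖ = 1) (p : Nat.Primes) :
    -Real.log (1 - 1 / ((p : ℕ) : ℝ)) -
        (x p).arg ^ 2 / 2 * (1 / ((p : ℕ) : ℝ) + 8 * (1 / ((p : ℕ) : ℝ) ^ 2)) ≤
      (eulerLog x p).re := by
  set φ := (x p).arg with hφ
  have hN := norm_one_sub_div_prime_sq hx p
  have hne := one_sub_div_prime_ne_zero hx p
  have hq2 := one_div_prime_le_half p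
  have hq0 : 0 < 1 / ((p : ℕ) : ℝ) := one_div_pos.2 p.cast_pos
  rw [eulerLog_re, ← one_div_pow]
  set q := 1 / ((p : ℕ) : ℝ) with hq
  set N := ‖1 - x p / ((p : ℕ) : ℂ)‖ with hNd
  have hN0 : 0 < N := norm_pos_iff.2 hne
  have hq1 : 0 < 1 - q := by linarith
  have hcos := Real.one_sub_sq_div_two_le_cos (x := φ)
  have hle : N ^ 2 ≤ (1 - q) ^ 2 * (1 + q * φ ^ 2 / (1 - q) ^ 2) := by
    have e : (1 - q) ^ 2 * (1 + q * φ ^ 2 / (1 - q) ^ 2) = (1 - q) ^ 2 + q * φ ^ 2 := by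
      field_simp
    rw [hN, e]
    nlinarith
  have hpos : 0 < 1 + q * φ ^ 2 / (1 - q) ^ 2 := by positivity
  have h1 := Real.log_le_log (by positivity) hle
  rw [Real.log_pow, Real.log_mul (by positivity) hpos.ne', Real.log_pow] at h1
  have h2 := Real.log_le_sub_one_of_pos hpos
  have h3 : q * φ ^ 2 / (1 - q) ^ 2 ≤ φ ^ 2 * (q + 8 * q ^ 2) := by
    rw [div_le_iff₀ (by positivity)]
    have h4 : q ≤ (q + 8 * q ^ 2) * (1 - q) ^ 2 := by
      have h5 : 1 / 4 ≤ (1 - q) ^ 2 := by nlinarith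
      nlinarith [mul_le_mul_of_nonneg_left h5 (sq_nonneg q), mul_pos hq0 (mul_pos hq0 hq0)]
    nlinarith [mul_le_mul_of_nonneg_left h4 (sq_nonneg φ)]
  push_cast at h1
  linarith

/-- For `z = 1 - x p / p` the sine of `-arg z` is `sin φ / (p ‖z‖)`; here `‖z‖ ≤ 1` since `cos φ ≥
1/2`, and `sin t ≤ t`. -/
theorem eulerLog_im_ge (hx : ∀ p, ‖x p‖ = 1) (p : Nat.Primes) (h0 : 0 < (x p).arg)
    (h1 : (x p).arg ≤ 1) :
    1 / ((p : ℕ) : ℝ) * Real.sin (x p).arg ≤ (eulerLog x p).im := by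
  have hN := norm_one_sub_div_prime_sq hx p
  have hne := one_sub_div_prime_ne_zero hx p
  have him := one_sub_div_prime_im hx p
  have hq2 := one_div_prime_le_half p
  have hq0 : 0 < 1 / ((p : ℕ) : ℝ) := one_div_pos.2 p.cast_pos
  rw [eulerLog, Complex.neg_im, Complex.log_im]
  set φ := (x p).arg with hφ
  set q := 1 / ((p : ℕ) : ℝ) with hq
  set z := 1 - x p / ((p : ℕ) : ℂ) with hz
  have hsin : 0 < Real.sin φ := Real.sin_pos_of_pos_of_lt_pi h0 (by linarith [Real.pi_gt_three])
  have hN0 : 0 < ‖z‖ := norm_pos_iff.2 hne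
  have hcos : 1 / 2 ≤ Real.cos φ := by
    have := Real.one_sub_sq_div_two_le_cos (x := φ)
    nlinarith
  have hN1 : ‖z‖ ≤ 1 := by
    have : ‖z‖ ^ 2 ≤ 1 ^ 2 := by rw [hN]; nlinarith
    exact le_of_sq_le_sq this zero_le_one
  have harg : z.arg < 0 := by
    rw [Complex.arg_neg_iff, him]
    have := mul_pos hq0 hsin
    linarith
  have hs := Complex.sin_arg z
  have h2 : Real.sin (-z.arg) ≤ -z.arg := Real.sin_le (by linarith)
  rw [Real.sin_neg, hs, him, neg_div, neg_neg] at h2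
  refine le_trans ?_ h2
  rw [le_div_iff₀ hN0]
  exact mul_le_of_le_one_right (mul_pos hq0 hsin).le hN1

theorem logPartial_re_ge (hx : ∀ p, ‖x p‖ = 1) {y : ℕ} {b : ℝ}
    (h : ∀ p ∈ primesUpTo y, |(x p).arg| ≤ b) :
    (∑ p ∈ primesUpTo y, -Real.log (1 - 1 / ((p : ℕ) : ℝ))) -
        b ^ 2 / 2 * ((∑ p ∈ primesUpTo y, 1 / ((p : ℕ) : ℝ)) +
          8 * ∑' p : Nat.Primes, 1 / ((p : ℕ) : ℝ) ^ 2) ≤ (logPartial x y).re := by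
  rw [logPartial, Complex.re_sum]
  have h1 : ∑ p ∈ primesUpTo y, 1 / ((p : ℕ) : ℝ) ^ 2 ≤ ∑' p : Nat.Primes, 1 / ((p : ℕ) : ℝ) ^ 2 :=
    summable_one_div_primes_sq.sum_le_tsum _ fun p _ => by positivity
  calc _ ≤ (∑ p ∈ primesUpTo y, -Real.log (1 - 1 / ((p : ℕ) : ℝ))) -
        b ^ 2 / 2 * ((∑ p ∈ primesUpTo y, 1 / ((p : ℕ) : ℝ)) +
          8 * ∑ p ∈ primesUpTo y, 1 / ((p : ℕ) : ℝ) ^ 2) := by gcongr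
    _ = ∑ p ∈ primesUpTo y, (-Real.log (1 - 1 / ((p : ℕ) : ℝ)) -
          b ^ 2 / 2 * (1 / ((p : ℕ) : ℝ) + 8 * (1 / ((p : ℕ) : ℝ) ^ 2))) := by
        rw [Finset.mul_sum, ← Finset.sum_add_distrib, Finset.mul_sum, Finset.sum_sub_distrib]
    _ ≤ _ := Finset.sum_le_sum fun p hp => by
        refine le_trans ?_ (eulerLog_re_ge hx p)
        gcongr ?_ - ?_ / 2 * ?_
        exact sq_le_sq.2 ((h p hp).trans (le_abs_self b))

theorem logPartial_im_ge (hx : ∀ p, ‖x p‖ = 1) {y : ℕ} {a b : ℝ} (ha : 0 < a) (hb : b ≤ 1)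
    (h : ∀ p ∈ primesUpTo y, (x p).arg ∈ Set.Icc a b) :
    (a - a ^ 3) * ∑ p ∈ primesUpTo y, 1 / ((p : ℕ) : ℝ) ≤ (logPartial x y).im := by
  rw [logPartial, Complex.im_sum, Finset.mul_sum]
  refine Finset.sum_le_sum fun p hp => ?_
  have hp := h p hp
  refine le_trans ?_ (eulerLog_im_ge hx p (ha.trans_le hp.1) (hp.2.trans hb))
  rw [mul_comm]
  have hpi := Real.pi_gt_three
  have h1 : Real.sin a ≤ Real.sin (x p).arg :=
    Real.sin_le_sin_of_le_of_le_pi_div_two (by linarith) (by linarith [hp.2]) hp.1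
  have h2 := Real.sin_gt_sub_cube ha
  gcongr
  have : 0 < a ^ 3 := by positivity
  linarith

theorem primesUpTo_card (y : ℕ) : (primesUpTo y).card = Nat.primeCounting y := by
  rw [Finset.card_eq_sum_ones, sum_primesUpTo (fun _ => 1), ← Finset.card_eq_sum_ones]
  rw [Nat.primesLE_eq_filter_range, Nat.primeCounting, Nat.primeCounting',
    Nat.count_eq_card_filter_range]

/-- Chebyshev's bound with the cutoff `√y`: the main term has constant `2 log 4 < 4`, and `√y ≤ 2y /
log y` adds `2`. -/
theorem primesUpTo_card_le {y : ℕ} (hy : 2 ≤ y) :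
    ((primesUpTo y).card : ℝ) ≤ 6 * y / Real.log y := by
  have hy2 : (2 : ℝ) ≤ y := by exact_mod_cast hy
  have hlog : 0 < Real.log y := Real.log_pos (by linarith)
  have h := Chebyshev.pi_le_log4_mul_div (x := y) (by linarith)
  rw [Nat.floor_natCast, ← primesUpTo_card] at h
  refine h.trans ?_
  rw [Real.log_sqrt (by linarith)]
  have hs : 0 < √(y : ℝ) := Real.sqrt_pos.2 (by linarith)
  have h1 := Real.log_le_sub_one_of_pos hs
  rw [Real.log_sqrt (by linarith)] at h1
  have h2 : √(y : ℝ) * √(y : ℝ) = y := Real.mul_self_sqrt (by linarith)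
  have h3 := log_four_lt_two
  rw [div_add' _ _ _ (by positivity), div_le_div_iff₀ (by positivity) hlog]
  have h4 : √(y : ℝ) * (Real.log y / 2) ≤ y := by nlinarith
  have h5 : Real.log 4 * y ≤ 2 * y := by nlinarith
  nlinarith

theorem exp_le_one_add_add_sq {v : ℝ} (h0 : 0 ≤ v) (h1 : v ≤ 1) : Real.exp v ≤ 1 + v + v ^ 2 := by
  have := (abs_le.1 (Real.abs_exp_sub_one_sub_id_le (x := v) (by rwa [abs_of_nonneg h0]))).2
  linarith

end LowerBound

/-! ### The lower bound for the joint tail -/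

section LowerTail

variable {Ω : Type*} [MeasurableSpace Ω] {P : Measure Ω} {X : Nat.Primes → Ω → ℂ}

/-- If all `X p` with `p ≤ y` lie on the arc of half-width `ε` around `exp (i α)`, then `L(1, X)`
is large with large argument, up to the contribution of the primes above `y`. -/
theorem IsSteinhaus.le_jointTail (h : IsSteinhaus P X) [IsProbabilityMeasure P]
    (hm : ∀ p, Measurable (X p)) (hn : ∀ p ω, ‖X p ω‖ = 1) {τ θ α ε : ℝ} {y : ℕ} (hτ : 1 ≤ τ)
    (hy : 96 * τ ^ 2 ≤ y) (hy1 : 1 ≤ Real.log y) (hε : 0 < ε) (ha : 0 < α - ε) (hb : α + ε ≤ 1)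
    (hre : Real.eulerMascheroniConstant + Real.log τ + 1 / τ ≤
      (∑ p ∈ primesUpTo y, -Real.log (1 - 1 / ((p : ℕ) : ℝ))) -
        (α + ε) ^ 2 / 2 * ((∑ p ∈ primesUpTo y, 1 / ((p : ℕ) : ℝ)) +
          8 * ∑' p : Nat.Primes, 1 / ((p : ℕ) : ℝ) ^ 2))
    (him : θ + 1 / τ ≤ ((α - ε) - (α - ε) ^ 3) * ∑ p ∈ primesUpTo y, 1 / ((p : ℕ) : ℝ)) :
    (ε / Real.pi) ^ (primesUpTo y).card / 2 ≤ jointTail P X τ θ := by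
  have hτ0 : 0 < τ := by linarith
  have hpi := Real.pi_gt_three
  have hy96 : (96 : ℝ) ≤ y := le_trans (by nlinarith) hy
  have hy2 : 2 ≤ y := by
    have : (2 : ℝ) ≤ y := by linarith
    exact_mod_cast this
  set D : Set ℂ := {w | w.arg ∈ Set.Icc (α - ε) (α + ε)} with hDdef
  have hD : MeasurableSet D := Complex.measurable_arg measurableSet_Icc
  have hDreal : ε / Real.pi ≤ circleUniform.real D := by
    have h1 := ENNReal.toReal_mono (measure_ne_top _ _)
      (le_circleUniform_arc (α := α) (ε := ε) (by linarith) (by linarith))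
    rwa [ENNReal.toReal_ofReal (by positivity)] at h1
  -- With `r = 4τ` and `δ = 1/τ` the product `rδ` is `4`, while `y ≥ 96 τ²` keeps the moment
  -- exponent below `1`; and `exp(-3) ≤ 1/4`.
  have hcond : Real.exp (((4 * τ) + (4 * τ) ^ 2 / 2) * (2 * Real.log 4 / (y * Real.log y)) -
      4 * τ * (1 / τ)) ≤ 1 / 4 := by
    have hy0 : (0 : ℝ) < y := by linarith
    have h1 : ((4 * τ) + (4 * τ) ^ 2 / 2) * (2 * Real.log 4 / (y * Real.log y)) ≤ 1 := by
      have h4 := log_four_lt_two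
      have h40 : 0 < Real.log 4 := Real.log_pos (by norm_num)
      rw [mul_div_assoc', div_le_one (by positivity)]
      calc ((4 * τ) + (4 * τ) ^ 2 / 2) * (2 * Real.log 4)
          ≤ (12 * τ ^ 2) * (2 * 2) := by
            gcongr
            nlinarith
        _ ≤ (y : ℝ) := by linarith
        _ ≤ (y : ℝ) * Real.log y := le_mul_of_one_le_right hy0.le hy1
    have h2 : 4 * τ * (1 / τ) = 4 := by field_simp
    rw [h2]
    calc _ ≤ Real.exp (-3) := Real.exp_le_exp.2 (by linarith)
      _ ≤ 1 / 4 := by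
        rw [Real.exp_neg, one_div]
        refine inv_anti₀ (by norm_num) ?_
        linarith [Real.add_one_le_exp 3]
  have key := h.half_le_measure_inter hm hn hD hy2 (r := 4 * τ) (by linarith) hcond
  rw [Finset.prod_const] at key
  rw [h.jointTail_eq hm hn hτ0]
  refine le_trans ?_ (key.trans (measureReal_mono ?_))
  · gcongr
  · rintro ω ⟨h1, h2, h3⟩
    have hx : ∀ p, ‖X p ω‖ = 1 := fun p => hn p ω
    have hRe := logPartial_re_ge (x := fun p => X p ω) hx (y := y) (b := α + ε) fun p hp =>
      abs_le.2 ⟨by linarith [(h1 p hp).1], (h1 p hp).2⟩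
    have hIm := logPartial_im_ge (x := fun p => X p ω) hx ha hb h1
    rw [Complex.sub_re] at h2
    rw [Complex.sub_im] at h3
    refine ⟨by linarith, lt_of_lt_of_le ?_ (le_abs_self _)⟩
    linarith

set_option maxHeartbeats 1000000 in
theorem exists_le_jointTail {A : ℝ} (hA : 0 < A) :
    ∃ K τ₀ : ℝ, 0 < K ∧ ∀ τ β : ℝ, τ₀ ≤ τ → 0 < β → β * Real.log τ ≤ A → 1 ≤ β ^ 2 * τ →
      Real.log (Real.log τ) ≤ β ^ 2 * τ →
      ∀ {Ω : Type*} [MeasurableSpace Ω] (P : Measure Ω) [IsProbabilityMeasure P]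
        (X : Nat.Primes → Ω → ℂ), IsSteinhaus P X → (∀ p, Measurable (X p)) →
        (∀ p ω, ‖X p ω‖ = 1) →
        Real.exp (-(Real.exp (τ + β ^ 2 * Real.log τ * τ / 2 + K * (β ^ 2 * τ)) / τ)) ≤
          jointTail P X τ (β * Real.log τ) := by
  obtain ⟨C, hC0, hC⟩ := exists_mertens
  set V : ℝ := ∑' p : Nat.Primes, 1 / ((p : ℕ) : ℝ) ^ 2 with hV
  have hV0 : 0 ≤ V := tsum_nonneg fun p => by positivity
  -- With `b = β / log τ`, the centre is `α = β + K₁ b`. In `K₁`, `8A` covers the cube in `sin a ≥ a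
  -- - a³`, one `A` covers the half-width `1/τ ≤ β² ≤ A b`, and `C + 2` offsets the loss of `C` in
  -- `∑ 1/p ≥ log τ - C`. `K₃` bounds the upper end of the arc.
  set K₁ := 9 * A + C + 2 with hK₁
  set K₃ := K₁ + A with hK₃
  -- Costs in units of `β²`: `2C` from `C / log y`, the next two terms from the quadratic loss in
  -- the real part, and `5 = 2 + 1 + 2` from `v ≤ 1`, the margin `1/τ`, and rounding in `log log y`.
  set K := 2 * C + 3 * K₃ / 2 + 2 * (C + 8 * V) + 5 with hK
  have hK₃0 : 0 < K₃ := by linarith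
  have hK0 : 0 < K := by linarith
  set L := A ^ 2 + 2 * K + K₃ + C * (C + 2) + 25 + 2 * A with hL
  -- `A²` pays for `exp v ≤ 1 + v + v²` and `2` for the surplus `log τ`. The number `1152 = 12 · 96`
  -- turns `y ≥ exp(τ)/2 ≥ τ³/12` into `y ≥ 96 τ²`.
  refine ⟨K + A ^ 2 + 2, max 1152 (Real.exp L), by positivity, ?_⟩
  intro τ β hτ hβ0 hβA hβτ hllτ Ω _ P _ X h hm hn
  set l := Real.log τ with hl
  have hτ1 : 1152 ≤ τ := (le_max_left _ _).trans hτ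
  have hτ0 : 0 < τ := by linarith
  have hLl : L ≤ l := by
    rw [hl, Real.le_log_iff_exp_le hτ0]; exact (le_max_right _ _).trans hτ
  have hA2 : 0 < A ^ 2 := by positivity
  have hCC : 0 < C * (C + 2) := by positivity
  have hl25 : 25 ≤ l := by linarith
  have hl0 : 0 < l := by linarith
  have hβ2 : 0 < β ^ 2 := by positivity
  have hβ1 : β ≤ 1 := by
    have : β * l ≤ 1 * l := by linarith
    exact le_of_mul_le_mul_right this hl0
  have hβhalf : 2 * β ≤ 1 := by
    have : 2 * β * l ≤ 1 * l := by linarith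
    exact le_of_mul_le_mul_right this hl0
  have hinv : 1 / τ ≤ β ^ 2 := by rwa [div_le_iff₀ hτ0]
  have hββ : β ^ 2 ≤ β := by nlinarith only [hβ0, hβ1]
  -- the quotient `b = β / log τ`
  set b := β / l with hb
  have hb0 : 0 < b := by positivity
  have hbl : b * l = β := div_mul_cancel₀ _ hl0.ne'
  have hβAb : β ^ 2 ≤ A * b := by
    have : β ^ 2 * l ≤ A * b * l := by
      rw [mul_assoc, hbl]; nlinarith only [hβA, hβ0]
    exact le_of_mul_le_mul_right this hl0
  have hLK₃ : K₃ ≤ l := by linarith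
  have hLC : C * (C + 2) ≤ l := by linarith
  have hLK : 2 * K ≤ l := by linarith
  have hLA : A ^ 2 ≤ l := by linarith
  have hK₃b : K₃ * b ≤ β := by rw [← hbl]; nlinarith only [hLK₃, hb0]
  have hCb : C * (C + 2) * b ≤ β := by rw [← hbl]; nlinarith only [hLC, hb0]
  -- the size of the main parameter
  set v := β ^ 2 * l / 2 + K * β ^ 2 with hv
  have hv0 : 0 ≤ v := by positivity
  have hvl : v ≤ β ^ 2 * l := by rw [hv]; nlinarith only [hLK, hβ2]
  have hβ2l : β ^ 2 * l ≤ A * β := by nlinarith only [hβA, hβ0]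
  have hv1 : v ≤ 1 := by
    have : A * β ≤ 1 := by
      have : A * β * l ≤ 1 * l := by nlinarith only [hβA, hA, hLA]
      exact le_of_mul_le_mul_right this hl0
    linarith
  have hv2 : v ^ 2 ≤ A ^ 2 * β ^ 2 := by
    rw [← mul_pow]
    exact pow_le_pow_left₀ hv0 (hvl.trans hβ2l) 2
  set w := τ * Real.exp v with hw
  have hτw : τ ≤ w := le_mul_of_one_le_right hτ0.le (Real.one_le_exp hv0)
  have hw0 : 0 < w := by linarith
  set y := ⌊Real.exp w⌋₊ with hy
  have hylo : w - 1 ≤ Real.log y := sub_one_le_log_floor_exp hw0.le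
  have hyhi : Real.log y ≤ w := log_floor_exp_le hw0.le
  have hyhalf : Real.exp w / 2 ≤ y := half_le_floor (Real.one_le_exp hw0.le)
  have hyexp : (y : ℝ) ≤ Real.exp w := Nat.floor_le (Real.exp_pos _).le
  have hlogy : τ / 2 ≤ Real.log y := by linarith
  have hlogy0 : 0 < Real.log y := by linarith
  have hy96 : 96 * τ ^ 2 ≤ y := by
    have h1 := Real.pow_div_factorial_le_exp (x := τ) hτ0.le 3
    have h2 := Real.exp_le_exp.2 hτw
    have h3 : (Nat.factorial 3 : ℝ) = 6 := by norm_num [Nat.factorial]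
    rw [h3] at h1
    have h4 : 1152 * τ ^ 2 ≤ τ ^ 3 := by nlinarith only [sq_nonneg τ, hτ1]
    linarith
  have hyτ : τ ≤ y := by nlinarith only [hy96, hτ1]
  have hy2 : 2 ≤ y := by
    have : (2 : ℝ) ≤ y := by linarith
    exact_mod_cast this
  have hlogw : Real.log w = l + v := by
    rw [hw, Real.log_mul hτ0.ne' (Real.exp_ne_zero _), Real.log_exp]
  have hllhi : Real.log (Real.log y) ≤ l + v := by
    rw [← hlogw]; exact Real.log_le_log hlogy0 hyhi
  have hlllo : l + v - 2 * β ^ 2 ≤ Real.log (Real.log y) := by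
    have h1 : Real.log (w - 1) ≤ Real.log (Real.log y) := Real.log_le_log (by linarith) hylo
    have h2 := Real.one_sub_inv_le_log_of_pos (div_pos (show 0 < w - 1 by linarith) hw0)
    rw [Real.log_div (by linarith) hw0.ne', inv_div, hlogw] at h2
    have h3 : w / (w - 1) ≤ 1 + 2 * (1 / τ) := by
      rw [div_le_iff₀ (by linarith)]
      have h4 : 2 * (1 / τ) * (w - 1) ≥ 1 := by
        have : τ ≤ 2 * (w - 1) := by linarith
        calc 2 * (1 / τ) * (w - 1) = 2 * (w - 1) / τ := by ring
          _ ≥ 1 := by rwa [ge_iff_le, le_div_iff₀ hτ0, one_mul]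
      have e : (1 + 2 * (1 / τ)) * (w - 1) = w - 1 + 2 * (1 / τ) * (w - 1) := by ring
      linarith only [h4, e]
    linarith
  obtain ⟨hm2, hm3⟩ := hC y hy2
  rw [abs_le] at hm2 hm3
  have hClog : C / Real.log y ≤ 2 * C * β ^ 2 := by
    calc C / Real.log y ≤ C / (τ / 2) := by gcongr
      _ = 2 * C * (1 / τ) := by field_simp
      _ ≤ _ := by gcongr
  set s := ∑ p ∈ primesUpTo y, 1 / ((p : ℕ) : ℝ) with hs
  have hs0 : 0 ≤ s := Finset.sum_nonneg fun p _ => by positivity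
  set α := β + K₁ * b with hα
  have ha_lo : β + (K₁ - A) * b ≤ α - 1 / τ := by
    rw [hα, sub_mul]; linarith only [hinv, hβAb]
  have ha_hi : α - 1 / τ ≤ 2 * β := by
    have : 0 < 1 / τ := by positivity
    have : K₁ * b ≤ K₃ * b := by gcongr; linarith
    linarith
  have ha0 : 0 < α - 1 / τ := by
    have : 0 ≤ (K₁ - A) * b := mul_nonneg (by linarith) hb0.le
    linarith
  have hb_hi : α + 1 / τ ≤ β + K₃ * b := by
    rw [hα, hK₃, add_mul]; linarith only [hinv, hβAb]
  have hbpos : 0 ≤ α + 1 / τ := by positivity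
  have hb_hi2 : α + 1 / τ ≤ 2 * β := by linarith
  have him : β * l + 1 / τ ≤ ((α - 1 / τ) - (α - 1 / τ) ^ 3) * s := by
    have h1 : (α - 1 / τ) ^ 3 ≤ 8 * A * b := by
      calc (α - 1 / τ) ^ 3 ≤ (2 * β) ^ 3 := by gcongr
        _ = 8 * (β * β ^ 2) := by ring
        _ ≤ 8 * (1 * (A * b)) := by gcongr
        _ = _ := by ring
    have h2 : β + (C + 2) * b ≤ (α - 1 / τ) - (α - 1 / τ) ^ 3 := by
      have : (K₁ - A) * b = (C + 2) * b + 8 * A * b := by rw [hK₁]; ring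
      linarith
    have h3 : 0 ≤ 2 * β ^ 2 ∧ 2 * β ^ 2 ≤ v := ⟨by positivity, by
      have : 2 ≤ K := by linarith
      rw [hv]; nlinarith only [this, hβ2, hl0, mul_pos hβ2 hl0]⟩
    have h4 : l - C ≤ s := by linarith
    calc β * l + 1 / τ ≤ (β + (C + 2) * b) * (l - C) := by
          have : (β + (C + 2) * b) * (l - C) =
            β * l + 2 * β - C * (C + 2) * b + (C + 2) * (b * l - β) := by ring
          rw [this, hbl]
          linarith
      _ ≤ (β + (C + 2) * b) * s := by gcongr
      _ ≤ _ := by gcongr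
  have hre : Real.eulerMascheroniConstant + l + 1 / τ ≤
      (∑ p ∈ primesUpTo y, -Real.log (1 - 1 / ((p : ℕ) : ℝ))) -
        (α + 1 / τ) ^ 2 / 2 * (s + 8 * V) := by
    have h1 : (α + 1 / τ) ^ 2 ≤ β ^ 2 + 3 * K₃ * (β * b) := by
      calc (α + 1 / τ) ^ 2 ≤ (β + K₃ * b) ^ 2 := by gcongr
        _ = β ^ 2 + 2 * K₃ * (β * b) + K₃ * b * (K₃ * b) := by ring
        _ ≤ β ^ 2 + 2 * K₃ * (β * b) + K₃ * b * β := by gcongr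
        _ = _ := by ring
    have h2 : (α + 1 / τ) ^ 2 ≤ 4 * β ^ 2 := by
      calc (α + 1 / τ) ^ 2 ≤ (2 * β) ^ 2 := by gcongr
        _ = _ := by ring
    have h3 : s + 8 * V ≤ l + (1 + (C + 8 * V)) := by linarith
    have h4 : (α + 1 / τ) ^ 2 / 2 * (s + 8 * V) ≤
        β ^ 2 * l / 2 + 3 * K₃ / 2 * β ^ 2 + 2 * β ^ 2 * (1 + (C + 8 * V)) := by
      calc (α + 1 / τ) ^ 2 / 2 * (s + 8 * V)
          ≤ (α + 1 / τ) ^ 2 / 2 * (l + (1 + (C + 8 * V))) := by gcongr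
        _ = (α + 1 / τ) ^ 2 / 2 * l + (α + 1 / τ) ^ 2 / 2 * (1 + (C + 8 * V)) := by ring
        _ ≤ (β ^ 2 + 3 * K₃ * (β * b)) / 2 * l + 4 * β ^ 2 / 2 * (1 + (C + 8 * V)) := by gcongr
        _ = β ^ 2 * l / 2 + 3 * K₃ / 2 * (β * (b * l)) + 2 * β ^ 2 * (1 + (C + 8 * V)) := by ring
        _ = _ := by rw [hbl, ← sq]
    have h5 : v = β ^ 2 * l / 2 + (2 * C + 3 * K₃ / 2 + 2 * (C + 8 * V) + 5) * β ^ 2 := hv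
    linarith
  refine le_trans ?_ (h.le_jointTail hm hn (by linarith) hy96 (by linarith) (by positivity) ha0
    (by linarith) hre him)
  -- the probability that all `X p` with `p ≤ y` lie on the arc
  set N := (primesUpTo y).card with hN
  have hpi := Real.pi_gt_three
  have hpi0 := Real.pi_pos
  have hNle : (N : ℝ) ≤ 12 * y / τ := by
    refine (primesUpTo_card_le hy2).trans ?_
    calc 6 * (y : ℝ) / Real.log y ≤ 6 * y / (τ / 2) := by gcongr
      _ = _ := by field_simp; ring
  have hlogπ : Real.log (Real.pi * τ) ≤ 2 * l := by
    rw [Real.log_mul hpi0.ne' hτ0.ne']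
    have := Real.log_le_sub_one_of_pos hpi0
    have := Real.pi_lt_four
    linarith
  have hlogπ0 : 0 ≤ Real.log (Real.pi * τ) := Real.log_nonneg (by nlinarith only [hpi, hτ1])
  have hpow : (1 / τ / Real.pi) ^ N / 2 = Real.exp (-(N * Real.log (Real.pi * τ) + Real.log 2)) := by
    have e : 1 / τ / Real.pi = Real.exp (-Real.log (Real.pi * τ)) := by
      rw [Real.exp_neg, Real.exp_log (by positivity)]
      field_simp
    rw [e, ← Real.exp_nat_mul, neg_add, Real.exp_add, Real.exp_neg (Real.log 2),
      Real.exp_log two_pos]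
    rw [div_eq_mul_inv]
    congr 2
    ring
  rw [hpow]
  refine Real.exp_le_exp.2 (neg_le_neg ?_)
  have hlog2 : Real.log 2 ≤ y * l / τ := by
    have h1 := Real.log_two_lt_d9
    have h2 : 1 ≤ y * l / τ := by
      rw [le_div_iff₀ hτ0]; nlinarith only [hyτ, hl25, hτ1]
    linarith
  -- The only place where `log log τ ≤ β² τ` enters: the surplus factor `25 l ≤ l²` in the cost of
  -- the arc fits into the error term.
  have hll : l ^ 2 ≤ Real.exp (2 * (β ^ 2 * τ)) := by
    rw [two_mul, Real.exp_add, ← sq]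
    refine pow_le_pow_left₀ hl0.le ?_ 2
    rw [← Real.log_le_iff_le_exp hl0]
    exact hllτ
  have hwle : w ≤ τ + β ^ 2 * l * τ / 2 + (K + A ^ 2) * (β ^ 2 * τ) := by
    have h1 := exp_le_one_add_add_sq hv0 hv1
    calc w ≤ τ * (1 + v + A ^ 2 * β ^ 2) := by
          rw [hw]; gcongr; linarith
      _ = _ := by rw [hv]; ring
  calc (N : ℝ) * Real.log (Real.pi * τ) + Real.log 2
      ≤ 12 * y / τ * (2 * l) + y * l / τ := by gcongr
    _ = y * (25 * l) / τ := by ring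
    _ ≤ Real.exp w * Real.exp (2 * (β ^ 2 * τ)) / τ := by
        gcongr
        exact le_trans (by nlinarith only [hl25]) hll
    _ ≤ _ := by
        rw [← Real.exp_add]
        refine div_le_div_of_nonneg_right (Real.exp_le_exp.2 ?_) hτ0.le
        linarith

end LowerTail

/-! ### Conclusion: the two bounds combined -/

theorem exists_bounds {A : ℝ} (hA : 0 < A) :
    ∃ C τ₀ : ℝ, 0 < C ∧ 1 < τ₀ ∧
      ∀ {Ω : Type*} [MeasurableSpace Ω] (P : Measure Ω) [IsProbabilityMeasure P]
        (X : Nat.Primes → Ω → ℂ), IsSteinhaus P X → (∀ p, Measurable (X p)) →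
        (∀ p ω, ‖X p ω‖ = 1) → ∀ τ θ : ℝ, τ₀ ≤ τ →
          Real.log τ * Real.sqrt (Real.log (Real.log τ) / τ) < θ → θ ≤ A →
          ∃ E : ℝ, |E| ≤ C * (θ ^ 2 * τ / Real.log τ ^ 2) ∧
            jointTail P X τ θ =
              Real.exp (-(Real.exp (τ + θ ^ 2 * τ / (2 * Real.log τ) + E) / τ)) := by
  obtain ⟨K₁, τ₁, hK₁, h₁⟩ := exists_jointTail_le hA
  obtain ⟨K₂, τ₂, hK₂, h₂⟩ := exists_le_jointTail hA
  refine ⟨max K₁ K₂, max (max τ₁ τ₂) (Real.exp (Real.exp 1)), lt_max_of_lt_left hK₁,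
    lt_max_of_lt_right (by rw [Real.one_lt_exp_iff]; exact Real.exp_pos _), ?_⟩
  intro Ω _ P _ X h hm hn τ θ hτ hθ hθA
  have hτ1 : τ₁ ≤ τ := (le_max_left _ _).trans ((le_max_left _ _).trans hτ)
  have hτ2 : τ₂ ≤ τ := (le_max_right _ _).trans ((le_max_left _ _).trans hτ)
  have hτ3 : Real.exp (Real.exp 1) ≤ τ := (le_max_right _ _).trans hτ
  have hτ0 : 0 < τ := (Real.exp_pos _).trans_le hτ3
  set l := Real.log τ with hl
  have hle : Real.exp 1 ≤ l := by rwa [hl, Real.le_log_iff_exp_le hτ0]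
  have hl0 : 0 < l := (Real.exp_pos _).trans_le hle
  have hll : 1 ≤ Real.log l := by rwa [Real.le_log_iff_exp_le hl0]
  set β := θ / l with hβ
  have hθβ : β * l = θ := div_mul_cancel₀ _ hl0.ne'
  -- Divided by `log τ`, the lower bound on `θ` becomes `log log τ < β² τ`; since `log log τ ≥ 1` it
  -- also yields `β² τ ≥ 1`.
  have hsq : √(Real.log l / τ) < β := by rw [hβ, lt_div_iff₀ hl0, mul_comm]; exact hθ
  have hβ0 : 0 < β := (Real.sqrt_nonneg _).trans_lt hsq
  have hβ2 : Real.log l ≤ β ^ 2 * τ := by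
    have h3 := (Real.sqrt_lt' hβ0).1 hsq
    rw [div_lt_iff₀ hτ0] at h3
    exact h3.le
  have hup := h₁ τ β hτ1 hβ0 (by rwa [hθβ]) (hll.trans hβ2) P X h hm hn
  have hlo := h₂ τ β hτ2 hβ0 (by rwa [hθβ]) (hll.trans hβ2) hβ2 P X h hm hn
  rw [← hl, hθβ] at hup hlo
  have e1 : θ ^ 2 * τ / l ^ 2 = β ^ 2 * τ := by rw [hβ, div_pow]; ring
  have e2 : θ ^ 2 * τ / (2 * l) = β ^ 2 * l * τ / 2 := by
    rw [← hθβ]; field_simp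
  rw [e1, e2]
  set J := jointTail P X τ θ with hJ
  set M := τ + β ^ 2 * l * τ / 2 with hM
  have hJ0 : 0 < J := (Real.exp_pos _).trans_le hlo
  have hlogup := (Real.log_le_iff_le_exp hJ0).2 hup
  have hloglo := (Real.le_log_iff_exp_le hJ0).2 hlo
  have hneg : Real.exp (M - K₁ * (β ^ 2 * τ)) ≤ τ * -Real.log J := by
    have : Real.exp (M - K₁ * (β ^ 2 * τ)) / τ ≤ -Real.log J := by linarith
    rw [div_le_iff₀ hτ0] at this
    linarith
  have hneg2 : τ * -Real.log J ≤ Real.exp (M + K₂ * (β ^ 2 * τ)) := by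
    have : -Real.log J ≤ Real.exp (M + K₂ * (β ^ 2 * τ)) / τ := by linarith
    rw [le_div_iff₀ hτ0] at this
    linarith
  have hpos : 0 < τ * -Real.log J := (Real.exp_pos _).trans_le hneg
  -- `E` is forced by the required equation; the two bounds on `J` confine it to `[-K₁ β² τ, K₂ β²
  -- τ]`.
  refine ⟨Real.log (τ * -Real.log J) - M, ?_, ?_⟩
  · have h3 := (Real.le_log_iff_exp_le hpos).2 hneg
    have h4 := (Real.log_le_iff_le_exp hpos).2 hneg2
    have hq : 0 ≤ β ^ 2 * τ := by positivity
    have h5 : K₁ * (β ^ 2 * τ) ≤ max K₁ K₂ * (β ^ 2 * τ) := by gcongr; exact le_max_left _ _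
    have h6 : K₂ * (β ^ 2 * τ) ≤ max K₁ K₂ * (β ^ 2 * τ) := by gcongr; exact le_max_right _ _
    rw [abs_le]
    constructor <;> linarith
  · rw [add_sub_cancel, Real.exp_log hpos, mul_div_cancel_left₀ _ hτ0.ne', neg_neg,
      Real.exp_log hJ0]

theorem jointTail_congr {Ω : Type*} [MeasurableSpace Ω] {P : Measure Ω}
    {X X' : Nat.Primes → Ω → ℂ} (h : ∀ᵐ ω ∂P, ∀ p, X p ω = X' p ω) (τ θ : ℝ) :
    jointTail P X τ θ = jointTail P X' τ θ := by
  refine measureReal_congr ?_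
  filter_upwards [h] with ω hω
  have : (fun p => X p ω) = fun p => X' p ω := funext hω
  refine propext ?_
  change _ ∧ _ ↔ _ ∧ _
  rw [this]

theorem theorem3 (A : ℝ) :
    ∃ C τ₀ : ℝ, 0 < C ∧ 1 < τ₀ ∧
      ∀ {Ω : Type*} [MeasurableSpace Ω] (P : Measure Ω) [IsProbabilityMeasure P]
        (X : Nat.Primes → Ω → ℂ), IsSteinhaus P X →
        (∀ᵐ ω ∂P,
          Tendsto (eulerPartial (fun p => X p ω)) atTop (𝓝 (eulerL (fun p => X p ω))) ∧
          Tendsto (argPartial (fun p => X p ω)) atTop (𝓝 (argL (fun p => X p ω)))) ∧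
        ∀ τ θ : ℝ, τ₀ ≤ τ →
          Real.log τ * Real.sqrt (Real.log (Real.log τ) / τ) < θ → θ ≤ A →
          ∃ E : ℝ, |E| ≤ C * (θ ^ 2 * τ / Real.log τ ^ 2) ∧
            jointTail P X τ θ =
              Real.exp (-(Real.exp (τ + θ ^ 2 * τ / (2 * Real.log τ) + E) / τ)) := by
  -- The bounds need a positive cap on `θ`; enlarging `A` to `max A 1` only widens the range.
  obtain ⟨C, τ₀, hC, hτ₀, hE⟩ := exists_bounds (A := max A 1) (lt_max_of_lt_right one_pos)
  refine ⟨C, τ₀, hC, hτ₀, fun P _ X hX => ?_⟩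
  obtain ⟨X', hX', hm, hn, hXX'⟩ := hX.exists_normalized
  refine ⟨?_, fun τ θ hτ hθ hθA => ?_⟩
  · filter_upwards [hXX', hX'.ae_tendsto_logPartial hm hn, hX'.ae_eulerL_eq hm hn]
      with ω h1 h2 ⟨h3, h4⟩
    have e : (fun p => X p ω) = fun p => X' p ω := funext h1
    rw [e, h3, h4]
    exact ⟨tendsto_eulerPartial_of_logPartial (fun p => hn p ω) h2,
      tendsto_argPartial_of_logPartial (fun p => hn p ω) h2⟩
  · rw [jointTail_congr hXX']
    exact hE P X' hX' hm hn τ θ hτ hθ (hθA.trans (le_max_left _ _))
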